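/- **Setting.** A heap on $N\ge 1$ nodes is a permutation $H$ of $\{1,\dots,N\}$ with $H[j]<H[\lfloor j/2\rfloor]$ for $2\le j\le N$; the children of index $m$ are those of $2m,2m+1$ that are $\le N$. $\mathtt{RemoveMax}$ applied to a heap on $n$ nodes removes the root, moves the last node $H[n]$ to the root and sifts it down: at each step the children of its current index are compared with each other (if there are two) and the largest child is compared with the sifted node; if the sifted node is smaller, the two are exchanged, otherwise (or if there are no children) the process stops. A *move* $k$ on a heap $H$ on $i$ nodes is an index $1\le k\le i$; it is *valid* if $H[k]\le H[\lfloor (i+1)/2\rfloor]$. It produces the heap $H.\mathtt{unRemoveMax}(k)$ on $i+1$ nodes: the node at $k$ is removed, each of its proper ancestors is demoted one step along the path from the root to $k$, the removed node is put at index $i+1$, and the value $i+1$ is put at the root. The *credit* $cr(i,k)$ of a valid move $k$ on a heap on $i$ nodes is the number of comparisons of keys that $\mathtt{RemoveMax}$ performs on the heap produced by the move; $cr^{\max}(i)$ is the maximum of the credits of valid moves on heaps on $i$ nodes. A *strategy* $s$ is an infinite sequence $s_1,s_2,\dots$ of valid moves, applied consecutively, beginning with the one-element heap (so that move $s_i$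 is applied to a heap on $i$ nodes). Its loss of credit at move $i$ is $\lambda_s(i)=cr^{\max}(i)-cr(i,s_i)$. For $N\ge 2$, $s$ is *optimal for $N$* if its payoff $\sum_{i=2}^{N-1}cr(i,s_i)$ is at least the payoff $\sum_{i=2}^{N-1}cr(i,u_i)$ of every strategy $u$. For $i\ge 1$ let $\lambda^*(i)=1$ if $i=2^{\lceil \lg i\rceil}-4$ and $\lambda^*(i)=0$ otherwise, where $\lg=\log_2$. **Theorem.** 1. For every strategy $s$ and every $N\ge 2$, $$\sum_{i=2}^{N}\lambda_s(i)\;\ge\;\sum_{i=2}^{N}\lambda^*(i).$$ 2. For every $N\ge 2$, a strategy $s$ is optimal for $N$ if and only if $$\sum_{i=2}^{N-1}\lambda_s(i)=\sum_{i=2}^{N-1}\lambda^*(i).$$ 3. For every $N\ge 2$, $$\sum_{i=2}^{N-1}\lambda^*(i)=\max\{\lfloor \lg (N+3)\rfloor,3\}-3.$$ -/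

import Mathlib

/-!
Heaps, `RemoveMax`, the solitaire game of pull downs, strategies and their losses of credit.

A convex binary tree on `N` nodes is represented by a function `T : ℕ → ℕ` that gives the value
stored at each of the indices `1, …, N` (and is `0` at all other indices).  The children of the
index `m` are those of `2 * m`, `2 * m + 1` that are at most `N`, and its parent is `m / 2`.
-/

namespace PullDowns

/-- `H` is a heap on `N` nodes: a permutation of `{1, …, N}` whose values decrease along every
path from the root. -/
structure IsHeap (N : ℕ) (H : ℕ → ℕ) : Prop where
  bijOn : Set.BijOn H (Set.Icc 1 N) (Set.Icc 1 N)
  decreasing : ∀ j, 2 ≤ j → j ≤ N → H j < H (j / 2)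
  support : ∀ j, j ∉ Set.Icc 1 N → H j = 0

/-- The number of children of the index `m` in a convex binary tree on `N` nodes. -/
def numChildren (N m : ℕ) : ℕ :=
  if 2 * m < N then 2 else if 2 * m = N then 1 else 0

/-- The index of the largest child of `m`, for `m` with at least one child (`2 * m ≤ N`). -/
def largestChild (N : ℕ) (T : ℕ → ℕ) (m : ℕ) : ℕ :=
  if 2 * m + 1 ≤ N ∧ T (2 * m) < T (2 * m + 1) then 2 * m + 1 else 2 * m

/-- The number of comparisons of keys performed by `FixHeap` on a convex binary tree `T` on `N`
nodes when its patch is at the index `m`.  If `m` has children, then `FixHeap` compares the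
children with each other (if there are two) and the largest of them with the patch, which takes
`numChildren N m` comparisons; if the patch is less than its largest child, the two are exchanged
and the process continues from the index of that child, and otherwise it stops. -/
def fixHeapComparisons (N : ℕ) (T : ℕ → ℕ) (m : ℕ) : ℕ :=
  if 1 ≤ m ∧ 2 * m ≤ N then
    let c := largestChild N T m
    if T m < T c then
      numChildren N m +
        fixHeapComparisons N (Function.update (Function.update T m (T c)) c (T m)) c
    else numChildren N m
  else 0
termination_by N - m
decreasing_by
  simp only [largestChild]
  split_ifs <;> omega

/-- The number of comparisons of keys performed by `RemoveMax` on a heap `H` on `n` nodes: the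
root is removed, its place is taken by the last node `H n`, and `FixHeap` is run from the root of
the resulting tree on `n - 1` nodes. -/
def removeMaxComparisons (n : ℕ) (H : ℕ → ℕ) : ℕ :=
  fixHeapComparisons (n - 1) (Function.update H 1 (H n)) 1

/-- The result of `unRemoveMax k` on a heap `H` on `N` nodes: the node at the index `k` is removed,
all its proper ancestors are demoted one step along the path from the root to `k`, the removed
node is attached at the index `N + 1`, and `N + 1` is put at the root. -/
def unRemoveMax (N : ℕ) (H : ℕ → ℕ) (k : ℕ) : ℕ → ℕ := fun j =>
  if j = N + 1 then H k
  else if j = 1 then N + 1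
  else if 2 ≤ j ∧ ∃ m ≤ k, k / 2 ^ m = j then H (j / 2)
  else H j

/-- `k` is a valid move (argument of `unRemoveMax`) for the heap `H` on `N` nodes. -/
def ValidMove (N : ℕ) (H : ℕ → ℕ) (k : ℕ) : Prop :=
  1 ≤ k ∧ k ≤ N ∧ H k ≤ H ((N + 1) / 2)

/-- The credit for the move `k` applied to the heap `H` on `i` nodes. -/
def credit (i : ℕ) (H : ℕ → ℕ) (k : ℕ) : ℕ :=
  removeMaxComparisons (i + 1) (unRemoveMax i H k)

/-- The maximal credit for a valid move applied to a heap on `i` nodes. -/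
noncomputable def creditMax (i : ℕ) : ℕ :=
  sSup {c : ℕ | ∃ (H : ℕ → ℕ) (k : ℕ), IsHeap i H ∧ ValidMove i H k ∧ c = credit i H k}

/-- The heap on `i ≥ 1` nodes that arises from the one-element heap by the moves
`move 1, …, move (i - 1)`. (The value at `i = 0` is irrelevant.) -/
def gameHeap (move : ℕ → ℕ) : ℕ → ℕ → ℕ
  | 0 => fun _ => 0
  | 1 => fun j => if j = 1 then 1 else 0
  | i + 2 => unRemoveMax (i + 1) (gameHeap move (i + 1)) (move (i + 1))

/-- A strategy: an infinite sequence of valid moves `move 1, move 2, …` applied consecutively,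
beginning with the one-element heap. (The entry `move 0` is not used.) -/
structure Strategy where
  move : ℕ → ℕ
  valid : ∀ i, 1 ≤ i → ValidMove i (gameHeap move i) (move i)

/-- The credit for the `i`-th move of the strategy `s`. -/
def Strategy.credit (s : Strategy) (i : ℕ) : ℕ :=
  PullDowns.credit i (gameHeap s.move i) (s.move i)

/-- The loss of credit for the `i`-th move of the strategy `s`. -/
noncomputable def Strategy.loss (s : Strategy) (i : ℕ) : ℤ :=
  (creditMax i : ℤ) - (s.credit i : ℤ)

/-- The payoff of the strategy `s` for its moves `n` through `m`. -/
def Strategy.payoff (s : Strategy) (n m : ℕ) : ℕ :=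
  ∑ i ∈ Finset.Icc n m, s.credit i

/-- The strategy `s` is optimal for `N`: its payoff for the construction of a heap on `N` nodes
cannot be beaten by any strategy. -/
def Strategy.IsOptimal (s : Strategy) (N : ℕ) : Prop :=
  ∀ u : Strategy, u.payoff 2 (N - 1) ≤ s.payoff 2 (N - 1)

/-- The delayed loss function; `Nat.clog 2 i` is the ceiling of the binary logarithm of `i ≥ 1`. -/
def delayedLoss (i : ℕ) : ℤ :=
  if (i : ℤ) = 2 ^ Nat.clog 2 i - 4 then 1 else 0

end PullDowns

/-! A move `k` earns two comparisons for each edge between the root and `k` and one for each child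
of `k`, less one if `k` is an only child (`credit_add`). Let `p = 2 ^ e`, and let the last level
start at `2 * p`. A lossless move then takes a node of that level or a non-leaf of the level above,
that is, an index of `InRegion`.

Lower bound. While the moves stay in the region, new values enter it only through leaves that
acquire children and through demoted parents (`region_values`). If the smallest leaf `m` of the
upper level bounds these from below, the children of `m` must be values that were in the region from
the start. `Obstructed` describes a heap on `2 * p - 3` nodes in which the values 1, 2, 3 are placed
so badly that too few such values are left. An obstructed level costs a credit between the moves `2
* p - 3` and `4 * p - 4` (`Obstructed.exists_loss`), and paying exactly one leaves the next level
obstructed (`Obstructed.succ`). Three lossless moves at the start of a level also obstruct the next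
one. Hence a strategy is either at the bound and obstructed, or at least one credit above it
(`sum_loss_window`).

Attainment. The strategy depends on the horizon. The moves `i - 1` drag the values 1 and 2 along as
the last two nodes, losing one credit at each power of two from 8 on. At the end, three lossless
moves rearrange 1, 2, 3, 4 so that the next power of two is free as well and the loss is put off
until `2 ^ (d + 4) - 4` (`pullMove`). Loss and payoff have a sum independent of the strategy, so
optimality means attaining the bound. -/

namespace PullDowns

/-! ### Paths to the root; `unRemoveMax` preserves heaps. -/

/-- The index `j` lies on the path from the root to the index `k`. -/
def OnPath (k j : ℕ) : Prop := ∃ m, k / 2 ^ m = j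

lemma onPath_self (k : ℕ) : OnPath k k := ⟨0, by simp⟩

lemma OnPath.half {k j : ℕ} (h : OnPath k j) : OnPath k (j / 2) := by
  obtain ⟨m, rfl⟩ := h
  exact ⟨m + 1, by rw [pow_succ, Nat.div_div_eq_div_mul]⟩

lemma OnPath.le {k j : ℕ} (h : OnPath k j) : j ≤ k := by
  obtain ⟨m, rfl⟩ := h
  exact Nat.div_le_self _ _

lemma OnPath.le_half {k a b : ℕ} (ha : OnPath k a) (hb : OnPath k b) (hab : a < b) :
    a ≤ b / 2 := by
  obtain ⟨x, rfl⟩ := ha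
  obtain ⟨y, rfl⟩ := hb
  have hxy : y < x := by
    by_contra h
    have h1 : 2 ^ x ≤ 2 ^ y := Nat.pow_le_pow_right (by norm_num) (not_lt.mp h)
    have h2 : k / 2 ^ y ≤ k / 2 ^ x := Nat.div_le_div_left h1 (by positivity)
    omega
  rw [Nat.div_div_eq_div_mul, ← pow_succ]
  exact Nat.div_le_div_left (Nat.pow_le_pow_right (by norm_num) hxy) (by positivity)

lemma OnPath.eq_or_two_mul_le {k j : ℕ} (h : OnPath k j) : j = k ∨ 2 * j ≤ k := by
  rcases h.le.eq_or_lt with h1 | h1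
  · exact Or.inl h1
  · have := h.le_half (onPath_self k) h1
    omega

lemma OnPath.eq_of_half_eq {k a b : ℕ} (ha : OnPath k a) (hb : OnPath k b) (h : a / 2 = b / 2)
    (h1 : 1 ≤ a / 2) : a = b := by
  rcases lt_trichotomy a b with hlt | heq | hlt
  · have := ha.le_half hb hlt
    omega
  · exact heq
  · have := hb.le_half ha hlt
    omega

lemma onPath_iff_bounded {k j : ℕ} (hj : 1 ≤ j) :
    (∃ m ≤ k, k / 2 ^ m = j) ↔ OnPath k j := by
  constructor
  · rintro ⟨m, -, h⟩
    exact ⟨m, h⟩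
  · rintro ⟨m, h⟩
    refine ⟨m, ?_, h⟩
    by_contra hlt
    have : k < 2 ^ m := (not_le.mp hlt).trans Nat.lt_two_pow_self
    rw [Nat.div_eq_of_lt this] at h
    omega

section unRemoveMax

variable {N k : ℕ} {H : ℕ → ℕ}

lemma unRemoveMax_last : unRemoveMax N H k (N + 1) = H k := by
  simp [unRemoveMax]

lemma unRemoveMax_root (hN : 1 ≤ N) : unRemoveMax N H k 1 = N + 1 := by
  have : (1 : ℕ) ≠ N + 1 := by omega
  simp [unRemoveMax]
  omega

lemma unRemoveMax_onPath {j : ℕ} (h2 : 2 ≤ j) (hj : j ≤ N) (h : OnPath k j) :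
    unRemoveMax N H k j = H (j / 2) := by
  have h1 : j ≠ N + 1 := by omega
  have h3 : j ≠ 1 := by omega
  have h4 := (onPath_iff_bounded (k := k) (j := j) (by omega)).2 h
  simp only [unRemoveMax, if_neg h1, if_neg h3, if_pos (And.intro h2 h4)]

lemma unRemoveMax_not_onPath {j : ℕ} (h2 : 2 ≤ j) (hj : j ≤ N) (h : ¬ OnPath k j) :
    unRemoveMax N H k j = H j := by
  have h1 : j ≠ N + 1 := by omega
  have h3 : j ≠ 1 := by omega
  have h4 : ¬ (2 ≤ j ∧ ∃ m ≤ k, k / 2 ^ m = j) := fun hc =>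
    h ((onPath_iff_bounded (by omega)).1 hc.2)
  simp only [unRemoveMax, if_neg h1, if_neg h3, if_neg h4]

end unRemoveMax

namespace IsHeap

variable {N : ℕ} {H : ℕ → ℕ}

lemma pos (hH : IsHeap N H) {j : ℕ} (h1 : 1 ≤ j) (h2 : j ≤ N) : 1 ≤ H j :=
  (hH.bijOn.mapsTo ⟨h1, h2⟩).1

lemma le (hH : IsHeap N H) {j : ℕ} (h1 : 1 ≤ j) (h2 : j ≤ N) : H j ≤ N :=
  (hH.bijOn.mapsTo ⟨h1, h2⟩).2

lemma ne (hH : IsHeap N H) {a b : ℕ} (ha : 1 ≤ a) (ha' : a ≤ N) (hb : 1 ≤ b) (hb' : b ≤ N)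
    (hab : a ≠ b) : H a ≠ H b :=
  fun h => hab (hH.bijOn.injOn ⟨ha, ha'⟩ ⟨hb, hb'⟩ h)

lemma exists_eq (hH : IsHeap N H) {v : ℕ} (h1 : 1 ≤ v) (h2 : v ≤ N) :
    ∃ j, 1 ≤ j ∧ j ≤ N ∧ H j = v := by
  obtain ⟨j, hj, rfl⟩ := hH.bijOn.surjOn (show v ∈ Set.Icc 1 N from ⟨h1, h2⟩)
  exact ⟨j, hj.1, hj.2, rfl⟩

lemma le_of_div (hH : IsHeap N H) {k : ℕ} (hk : k ≤ N) (r : ℕ) (hr : 1 ≤ k / 2 ^ r) :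
    H k ≤ H (k / 2 ^ r) := by
  induction r with
  | zero => simp
  | succ r ih =>
    have e : k / 2 ^ (r + 1) = k / 2 ^ r / 2 := by rw [pow_succ, Nat.div_div_eq_div_mul]
    rw [e] at hr ⊢
    have := Nat.div_le_self k (2 ^ r)
    exact (ih (by omega)).trans (hH.decreasing _ (by omega) (by omega)).le

lemma le_of_onPath (hH : IsHeap N H) {k j : ℕ} (hk : k ≤ N) (hj : 1 ≤ j) (h : OnPath k j) :
    H k ≤ H j := by
  obtain ⟨m, rfl⟩ := h
  exact hH.le_of_div hk m hj

lemma lt_of_onPath (hH : IsHeap N H) {k j : ℕ} (hk : k ≤ N) (hj : 1 ≤ j) (h : OnPath k j)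
    (hjk : j < k) : H k < H j :=
  lt_of_le_of_ne (hH.le_of_onPath hk hj h) (hH.ne (by omega) hk hj (by omega) (by omega))

lemma le_unRemoveMax (hH : IsHeap N H) {k j : ℕ} (h1 : 1 ≤ j) (h2 : j ≤ N) :
    H j ≤ unRemoveMax N H k j := by
  rcases h1.eq_or_lt with rfl | h1
  · rw [unRemoveMax_root h2]
    exact (hH.le le_rfl h2).trans (Nat.le_succ _)
  · by_cases hp : OnPath k j
    · rw [unRemoveMax_onPath h1 h2 hp]
      exact (hH.decreasing j h1 h2).le
    · rw [unRemoveMax_not_onPath h1 h2 hp]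

lemma unRemoveMax (hH : IsHeap N H) {k : ℕ} (hk : ValidMove N H k) :
    IsHeap (N + 1) (unRemoveMax N H k) := by
  obtain ⟨hk1, hkN, hkv⟩ := hk
  have hN : 1 ≤ N := hk1.trans hkN
  -- Every non-root value has one source index: the moved node, a demoted parent, or the index
  -- itself. Injectivity is then a comparison of sources.
  have key : ∀ j, 2 ≤ j → j ≤ N + 1 → ∃ i, 1 ≤ i ∧ i ≤ N ∧ PullDowns.unRemoveMax N H k j = H i ∧
      (j = N + 1 ∧ i = k ∨ j ≤ N ∧ OnPath k j ∧ i = j / 2 ∨ j ≤ N ∧ ¬ OnPath k j ∧ i = j) := by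
    intro j h2 hj
    rcases hj.eq_or_lt with rfl | hj
    · exact ⟨k, hk1, hkN, unRemoveMax_last, Or.inl ⟨rfl, rfl⟩⟩
    · by_cases hp : OnPath k j
      · exact ⟨j / 2, by omega, by omega, unRemoveMax_onPath h2 (by omega) hp,
          Or.inr (Or.inl ⟨by omega, hp, rfl⟩)⟩
      · exact ⟨j, by omega, by omega, unRemoveMax_not_onPath h2 (by omega) hp,
          Or.inr (Or.inr ⟨by omega, hp, rfl⟩)⟩
  have hmaps : Set.MapsTo (PullDowns.unRemoveMax N H k) (Set.Icc 1 (N + 1)) (Set.Icc 1 (N + 1)) := by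
    rintro j ⟨h1, h2⟩
    rcases h1.eq_or_lt with rfl | h1
    · rw [unRemoveMax_root hN]
      exact ⟨by omega, le_rfl⟩
    · obtain ⟨i, hi1, hi2, e, -⟩ := key j h1 h2
      rw [e]
      exact ⟨hH.pos hi1 hi2, (hH.le hi1 hi2).trans (Nat.le_succ _)⟩
  have hinj : Set.InjOn (PullDowns.unRemoveMax N H k) (Set.Icc 1 (N + 1)) := by
    have hroot : ∀ j, 2 ≤ j → j ≤ N + 1 →
        PullDowns.unRemoveMax N H k j ≠ PullDowns.unRemoveMax N H k 1 := by
      intro j h2 hj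
      obtain ⟨i, hi1, hi2, e, -⟩ := key j h2 hj
      rw [e, unRemoveMax_root hN]
      have := hH.le hi1 hi2
      omega
    rintro a ⟨ha1, ha2⟩ b ⟨hb1, hb2⟩ hab
    rcases ha1.eq_or_lt with rfl | ha1 <;> rcases hb1.eq_or_lt with rfl | hb1
    · rfl
    · exact absurd hab.symm (hroot b hb1 hb2)
    · exact absurd hab (hroot a ha1 ha2)
    · obtain ⟨i, hi1, hi2, ei, hi⟩ := key a ha1 ha2
      obtain ⟨l, hl1, hl2, el, hl⟩ := key b hb1 hb2
      rw [ei, el] at hab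
      have hil : i = l := hH.bijOn.injOn ⟨hi1, hi2⟩ ⟨hl1, hl2⟩ hab
      subst hil
      rcases hi with ⟨hi, rfl⟩ | ⟨hi, hp, hi'⟩ | ⟨hi, hp, rfl⟩ <;>
        rcases hl with ⟨hl, hl'⟩ | ⟨hl, hq, hl'⟩ | ⟨hl, hq, hl'⟩
      · omega
      · have := hq.le
        omega
      · exact absurd (hl' ▸ onPath_self i) hq
      · have := hp.le
        omega
      · exact hp.eq_of_half_eq hq (by omega) (by omega)
      · exact absurd (hl' ▸ hi' ▸ hp.half) hq
      · exact absurd (hl' ▸ onPath_self k) hp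
      · exact absurd (hl' ▸ hq.half) hp
      · exact hl'
  refine ⟨⟨hmaps, hinj, ?_⟩, ?_, ?_⟩
  · rw [← Finset.coe_Icc] at hmaps hinj ⊢
    exact Finset.surjOn_of_injOn_of_card_le _ hmaps hinj le_rfl
  · intro j h2 hj
    have hpar : ∀ q, 1 ≤ q → q ≤ N → H q ≤ PullDowns.unRemoveMax N H k q :=
      fun q h1 h2 => hH.le_unRemoveMax h1 h2
    have hpath : ∀ q, 1 ≤ q → q ≤ N → OnPath k q → H q < PullDowns.unRemoveMax N H k q := by
      intro q h1 hq hp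
      rcases h1.eq_or_lt with rfl | h1
      · rw [unRemoveMax_root hN]
        exact Nat.lt_succ_of_le (hH.le le_rfl hN)
      · rw [unRemoveMax_onPath h1 hq hp]
        exact hH.decreasing q h1 hq
    rcases hj.eq_or_lt with rfl | hj
    · rw [unRemoveMax_last]
      -- Validity is a weak inequality. Equality means that `k` is the parent of the new node, and
      -- then the parent is on the path and receives a strictly larger value.
      by_cases hp : OnPath k ((N + 1) / 2)
      · exact hkv.trans_lt (hpath _ (by omega) (by omega) hp)
      · refine lt_of_lt_of_le (lt_of_le_of_ne hkv (hH.ne hk1 hkN (by omega) (by omega) ?_))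
          (hpar _ (by omega) (by omega))
        intro e
        exact hp (e ▸ onPath_self k)
    · by_cases hp : OnPath k j
      · rw [unRemoveMax_onPath h2 (by omega) hp]
        exact hpath _ (by omega) (by omega) hp.half
      · rw [unRemoveMax_not_onPath h2 (by omega) hp]
        exact (hH.decreasing j h2 (by omega)).trans_le (hpar _ (by omega) (by omega))
  · intro j hj
    have h1 : j ≠ N + 1 := by
      rintro rfl
      exact hj ⟨by omega, le_rfl⟩
    have h3 : j ≠ 1 := by
      rintro rfl
      exact hj ⟨le_rfl, by omega⟩
    have h4 : ¬ (2 ≤ j ∧ ∃ m ≤ k, k / 2 ^ m = j) := by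
      rintro ⟨h2, hc⟩
      have := ((onPath_iff_bounded (by omega)).1 hc).le
      exact hj ⟨by omega, by omega⟩
    simp only [PullDowns.unRemoveMax, if_neg h1, if_neg h3, if_neg h4]
    exact hH.support j fun hc => hj ⟨hc.1, hc.2.trans (Nat.le_succ _)⟩

/-! ### The credit of a move and the maximal credit. -/

/-- Sifting retraces the path to `k`: the next path node holds the former value of its parent, which
exceeds the sibling, so it is the largest child, and it exceeds `H k`. The patch stops at `k`, above
the old children of `k`. Each step costs two comparisons, except the last one when `k = N` is an
only child. -/
lemma fixHeapComparisons_div (hH : IsHeap N H) {k : ℕ} (hk1 : 1 ≤ k) (hk : k ≤ N) (r : ℕ) :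
    ∀ T : ℕ → ℕ, 1 ≤ k / 2 ^ r → T (k / 2 ^ r) = H k →
      (∀ j, k / 2 ^ r < j → j ≤ N → OnPath k j → T j = H (j / 2)) →
      (∀ j, 1 ≤ j → j ≤ N → j ≠ k / 2 ^ r → ¬ (k / 2 ^ r < j ∧ OnPath k j) → T j = H j) →
      fixHeapComparisons N T (k / 2 ^ r) + (if r ≠ 0 ∧ k = N ∧ 2 ∣ N then 1 else 0)
        = 2 * r + numChildren N k := by
  induction r with
  | zero =>
    intro T _ h1 h2 h3
    simp only [pow_zero, Nat.div_one] at h1 h2 h3 ⊢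
    have hT : ∀ j, 1 ≤ j → j ≤ N → T j = H j := by
      intro j hj hjN
      by_cases hjk : j = k
      · rw [hjk, h1]
      · exact h3 j hj hjN hjk fun hc => absurd hc.2.le (by omega)
    rw [fixHeapComparisons]
    by_cases hc : 2 * k ≤ N
    · have hcs : largestChild N T k ≤ N ∧ largestChild N T k / 2 = k ∧
          2 ≤ largestChild N T k := by
        simp only [largestChild]
        split_ifs <;> omega
      have hlt := hH.decreasing _ hcs.2.2 hcs.1
      rw [hcs.2.1] at hlt
      have hn : ¬ T k < T (largestChild N T k) := by
        rw [hT k hk1 hk, hT _ (by omega) hcs.1]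
        omega
      simp [hk1, hc, hn]
    · have : numChildren N k = 0 := by
        simp only [numChildren]
        split_ifs <;> omega
      simp [hc, this]
  | succ r ih =>
    intro T hm h1 h2 h3
    have e : k / 2 ^ (r + 1) = k / 2 ^ r / 2 := by rw [pow_succ, Nat.div_div_eq_div_mul]
    rw [e] at hm h1 h2 h3 ⊢
    have hcp : OnPath k (k / 2 ^ r) := ⟨r, rfl⟩
    have hck : k / 2 ^ r ≤ k := hcp.le
    have hcr : k / 2 ^ r = k → r = 0 := by
      intro h
      by_contra hr
      have := Nat.div_lt_self hk1 (Nat.one_lt_two_pow hr)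
      omega
    have hc0 : r = 0 → k / 2 ^ r = k := by
      rintro rfl
      simp
    specialize ih (Function.update (Function.update T (k / 2 ^ r / 2) (T (k / 2 ^ r)))
      (k / 2 ^ r) (T (k / 2 ^ r / 2)))
    generalize k / 2 ^ r = c at *
    have hTc : T c = H (c / 2) := h2 c (by omega) (by omega) hcp
    have hlt : H k < H (c / 2) := hH.lt_of_onPath hk hm hcp.half (by omega)
    have hsib : ∀ s, s / 2 = c / 2 → s ≠ c → s ≤ N → T s < T c := by
      intro s hs hsc hsN
      rw [hTc, h3 s (by omega) hsN (by omega), ← hs]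
      · exact hH.decreasing s (by omega) hsN
      · rintro ⟨-, hsp⟩
        exact hsc (hsp.eq_of_half_eq hcp hs (by omega))
    have hlc : largestChild N T (c / 2) = c := by
      simp only [largestChild]
      rcases Nat.mod_two_eq_zero_or_one c with hc | hc
      · have h2c : 2 * (c / 2) = c := by omega
        rw [if_neg, h2c]
        rintro ⟨ha, hb⟩
        have := hsib (2 * (c / 2) + 1) (by omega) (by omega) ha
        rw [h2c] at hb this
        omega
      · have h2c : 2 * (c / 2) + 1 = c := by omega
        rw [if_pos, h2c]
        refine ⟨by omega, ?_⟩
        have := hsib (2 * (c / 2)) (by omega) (by omega) (by omega)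
        rwa [h2c]
    have hT' := ih (by omega) (by rw [Function.update_self, h1]) (by
      intro j hj hjN hp
      rw [Function.update_of_ne (by omega), Function.update_of_ne (by omega)]
      exact h2 j (by omega) hjN hp) (by
      intro j hj hjN hjc hnp
      rw [Function.update_of_ne hjc]
      by_cases hjm : j = c / 2
      · rw [hjm, Function.update_self, hTc]
      · rw [Function.update_of_ne hjm]
        refine h3 j hj hjN hjm ?_
        rintro ⟨hmj, hp⟩
        by_cases hcj : c < j
        · exact hnp ⟨hcj, hp⟩
        · have := hp.le_half hcp (by omega)
          omega)
    rw [fixHeapComparisons, if_pos ⟨hm, by omega⟩]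
    simp only [hlc]
    rw [if_pos (by rw [h1, hTc]; exact hlt)]
    have hnc : numChildren N (c / 2) + (if r + 1 ≠ 0 ∧ k = N ∧ 2 ∣ N then 1 else 0)
        = 2 + (if r ≠ 0 ∧ k = N ∧ 2 ∣ N then 1 else 0) := by
      by_cases hr : r = 0
      · have hc : c = k := by
          subst hr
          simp_all
        subst hc
        simp only [numChildren, hr]
        split_ifs <;> omega
      · have hc : c ≠ k := fun h => hr (hcr h)
        have : 2 * (c / 2) < N := by omega
        simp [numChildren, hr, this]
    omega

end IsHeap

lemma credit_add {i k : ℕ} {H : ℕ → ℕ} (hH : IsHeap i H) (hk1 : 1 ≤ k) (hk : k ≤ i) (hi : 2 ≤ i) :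
    credit i H k + (if k = i ∧ 2 ∣ i then 1 else 0) = 2 * Nat.log 2 k + numChildren i k := by
  have e : k / 2 ^ Nat.log 2 k = 1 := by
    have h1 := Nat.pow_log_le_self 2 (x := k) (by omega)
    have h2 := Nat.lt_pow_succ_log_self (b := 2) (by norm_num) k
    rw [pow_succ] at h2
    exact Nat.div_eq_of_lt_le (by omega) (by omega)
  have key := hH.fixHeapComparisons_div hk1 hk (Nat.log 2 k)
    (Function.update (unRemoveMax i H k) 1 (unRemoveMax i H k (i + 1)))
  rw [e] at key
  have := key le_rfl (by rw [Function.update_self, unRemoveMax_last])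
    (by
      intro j h1 hj hp
      rw [Function.update_of_ne (by omega), unRemoveMax_onPath h1 hj hp])
    (by
      intro j h1 hj hne hnp
      rw [Function.update_of_ne hne, unRemoveMax_not_onPath (by omega) hj]
      exact fun hp => hnp ⟨by omega, hp⟩)
  rw [credit, removeMaxComparisons, Nat.add_sub_cancel, ← this]
  congr 1
  by_cases hki : k = i
  · have : Nat.log 2 k ≠ 0 := by
      have := (Nat.log_pos_iff (b := 2) (n := k)).2 ⟨by omega, by norm_num⟩
      omega
    simp [this]
  · simp [hki]

/-- The heap with the values in decreasing order. -/
def decreasingHeap (n : ℕ) : ℕ → ℕ := fun j => if 1 ≤ j ∧ j ≤ n then n + 1 - j else 0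

lemma isHeap_decreasingHeap (n : ℕ) : IsHeap n (decreasingHeap n) := by
  refine ⟨⟨?_, ?_, ?_⟩, ?_, ?_⟩
  · rintro j ⟨h1, h2⟩
    simp only [decreasingHeap, h1, h2, and_self, if_true, Set.mem_Icc]
    omega
  · rintro a ⟨ha1, ha2⟩ b ⟨hb1, hb2⟩ hab
    simp only [decreasingHeap, ha1, ha2, hb1, hb2, and_self, if_true] at hab
    omega
  · rintro j ⟨h1, h2⟩
    refine ⟨n + 1 - j, ⟨by omega, by omega⟩, ?_⟩
    simp only [decreasingHeap]
    split_ifs <;> omega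
  · intro j h2 hj
    simp only [decreasingHeap]
    split_ifs <;> omega
  · intro j hj
    simp only [decreasingHeap]
    exact if_neg hj

lemma numChildren_le (i k : ℕ) : numChildren i k ≤ 2 := by
  simp only [numChildren]
  split_ifs <;> omega

/-- The greatest credit for a heap on `i` nodes whose last level is the level `E`. -/
def maxCredit (E i : ℕ) : ℕ := if i = 2 ^ E then 2 * E - 1 else 2 * E

lemma credit_le_maxCredit {E i k : ℕ} {H : ℕ → ℕ} (hH : IsHeap i H) (hk1 : 1 ≤ k) (hk : k ≤ i)
    (hE : 1 ≤ E) (h1 : 2 ^ E ≤ i) (h2 : i < 2 ^ (E + 1)) : credit i H k ≤ maxCredit E i := by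
  obtain ⟨e, rfl⟩ : ∃ e, E = e + 1 := ⟨E - 1, by omega⟩
  have hp : 1 ≤ 2 ^ e := Nat.one_le_two_pow
  simp only [maxCredit, pow_succ] at *
  have key := credit_add hH hk1 hk (by omega)
  have hl1 := Nat.pow_log_le_self 2 (x := k) (by omega)
  have hl2 := Nat.lt_pow_succ_log_self (b := 2) (by norm_num) k
  have hnc := numChildren_le i k
  rcases lt_trichotomy (Nat.log 2 k) e with hlt | heq | hgt
  · split_ifs at * <;> omega
  · rw [heq] at hl1 hl2 key
    simp only [numChildren] at *
    split_ifs at * <;> omega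
  · have hle : Nat.log 2 k ≤ e + 1 := by
      have : Nat.log 2 k < e + 2 := Nat.log_lt_of_lt_pow (by omega) (by rw [pow_succ, pow_succ]; omega)
      omega
    have heq : Nat.log 2 k = e + 1 := by omega
    rw [heq] at hl1 hl2 key
    rw [pow_succ] at hl1
    simp only [numChildren] at *
    split_ifs at * <;> omega

lemma creditMax_eq {E i : ℕ} (hE : 1 ≤ E) (h1 : 2 ^ E ≤ i) (h2 : i < 2 ^ (E + 1)) :
    creditMax i = maxCredit E i := by
  refine IsGreatest.csSup_eq ⟨?_, ?_⟩
  · have hH := isHeap_decreasingHeap i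
    have hp : 2 ≤ 2 ^ E := by
      calc 2 = 2 ^ 1 := rfl
        _ ≤ 2 ^ E := Nat.pow_le_pow_right (by norm_num) hE
    -- The first node of the last level is a leaf at maximal depth; in the decreasing heap it is a
    -- valid move because its index is at least `(i + 1) / 2`.
    refine ⟨decreasingHeap i, 2 ^ E, hH, ⟨by omega, h1, ?_⟩, ?_⟩
    · rw [pow_succ] at h2
      simp only [decreasingHeap]
      split_ifs <;> omega
    · have key := credit_add hH (k := 2 ^ E) (by omega) h1 (by omega)
      have h2i : 2 ∣ 2 ^ E := dvd_pow_self 2 (by omega)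
      rw [Nat.log_pow (by norm_num)] at key
      have hn : numChildren i (2 ^ E) = 0 := by
        rw [pow_succ] at h2
        simp only [numChildren]
        split_ifs <;> omega
      rw [hn] at key
      simp only [maxCredit]
      by_cases hi : i = 2 ^ E
      · subst hi
        simp only [h2i, and_self, if_true] at key ⊢
        omega
      · have : 2 ^ E ≠ i := fun h => hi h.symm
        simp only [hi, this, false_and, if_false] at key ⊢
        omega
  · rintro c ⟨H, k, hH, hk, rfl⟩
    exact credit_le_maxCredit hH hk.1 hk.2.1 hE h1 h2

lemma isHeap_gameHeap_one (move : ℕ → ℕ) : IsHeap 1 (gameHeap move 1) := by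
  refine ⟨⟨?_, ?_, ?_⟩, ?_, ?_⟩
  · rintro j ⟨h1, h2⟩
    obtain rfl : j = 1 := by omega
    simp [gameHeap]
  · rintro a ⟨ha1, ha2⟩ b ⟨hb1, hb2⟩ _
    omega
  · rintro j ⟨h1, h2⟩
    obtain rfl : j = 1 := by omega
    exact ⟨1, by simp, by simp [gameHeap]⟩
  · intro j h2 hj
    omega
  · intro j hj
    have : j ≠ 1 := by
      rintro rfl
      exact hj (by simp)
    simp [gameHeap, this]

lemma gameHeap_succ (move : ℕ → ℕ) {i : ℕ} (hi : 1 ≤ i) :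
    gameHeap move (i + 1) = unRemoveMax i (gameHeap move i) (move i) := by
  obtain ⟨j, rfl⟩ : ∃ j, i = j + 1 := ⟨i - 1, by omega⟩
  rfl

lemma isHeap_gameHeap {move : ℕ → ℕ} {n : ℕ} (hn : 1 ≤ n)
    (h : ∀ i, 1 ≤ i → i < n → ValidMove i (gameHeap move i) (move i)) :
    IsHeap n (gameHeap move n) := by
  induction n, hn using Nat.le_induction with
  | base => exact isHeap_gameHeap_one move
  | succ n hn ih =>
    rw [gameHeap_succ move hn]
    exact (ih fun i h1 h2 => h i h1 (by omega)).unRemoveMax (h n hn (by omega))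

namespace Strategy

/-- The heap on `n` nodes to which the strategy applies its `n`-th move. -/
def heap (s : Strategy) (n : ℕ) : ℕ → ℕ := gameHeap s.move n

variable (s : Strategy)

lemma isHeap {n : ℕ} (hn : 1 ≤ n) : IsHeap n (s.heap n) :=
  isHeap_gameHeap hn fun i h1 _ => s.valid i h1

lemma one_le_move {n : ℕ} (hn : 1 ≤ n) : 1 ≤ s.move n := (s.valid n hn).1

lemma move_le {n : ℕ} (hn : 1 ≤ n) : s.move n ≤ n := (s.valid n hn).2.1

lemma heap_succ_last {n : ℕ} (hn : 1 ≤ n) : s.heap (n + 1) (n + 1) = s.heap n (s.move n) := by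
  rw [heap, gameHeap_succ _ hn, unRemoveMax_last]
  rfl

lemma heap_succ_onPath {n j : ℕ} (h2 : 2 ≤ j) (hj : j ≤ n) (h : OnPath (s.move n) j) :
    s.heap (n + 1) j = s.heap n (j / 2) := by
  rw [heap, gameHeap_succ _ (by omega), unRemoveMax_onPath h2 hj h]
  rfl

lemma heap_succ_not_onPath {n j : ℕ} (h2 : 2 ≤ j) (hj : j ≤ n) (h : ¬ OnPath (s.move n) j) :
    s.heap (n + 1) j = s.heap n j := by
  rw [heap, gameHeap_succ _ (by omega), unRemoveMax_not_onPath h2 hj h]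
  rfl

/-- Demotion replaces a value only by that of an ancestor. -/
lemma heap_mono {n m j : ℕ} (h1 : 1 ≤ j) (hj : j ≤ n) (hnm : n ≤ m) :
    s.heap n j ≤ s.heap m j := by
  induction m, hnm using Nat.le_induction with
  | base => exact le_rfl
  | succ m hm ih =>
    refine ih.trans ?_
    have := (s.isHeap (n := m) (by omega)).le_unRemoveMax (k := s.move m) h1 (by omega)
    rwa [show s.heap (m + 1) = _ from gameHeap_succ s.move (by omega)]

lemma loss_eq {E i : ℕ} (hE : 1 ≤ E) (h1 : 2 ^ E ≤ i) (h2 : i < 2 ^ (E + 1)) :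
    s.loss i = (maxCredit E i : ℤ) - s.credit i := by
  rw [loss, creditMax_eq hE h1 h2]

lemma loss_nonneg {i : ℕ} (hi : 2 ≤ i) : 0 ≤ s.loss i := by
  have hl1 := Nat.pow_log_le_self 2 (x := i) (by omega)
  have hl2 := Nat.lt_pow_succ_log_self (b := 2) (by norm_num) i
  have hl := (Nat.log_pos_iff (b := 2) (n := i)).2 ⟨by omega, by norm_num⟩
  rw [s.loss_eq hl hl1 hl2]
  have := credit_le_maxCredit (s.isHeap (n := i) (by omega)) (s.one_le_move (by omega))
    (s.move_le (by omega)) hl hl1 hl2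
  rw [Strategy.credit]
  exact sub_nonneg.2 (by exact_mod_cast this)

end Strategy

/-! ### Moves with little loss stay in the region of the two lowest levels. -/

/-- The indices at the two lowest levels of a heap on `n` nodes that are not leaves of the upper
one of these levels, which starts at the index `p`. -/
def InRegion (p n j : ℕ) : Prop := p ≤ j ∧ 2 * j ≤ n ∨ 2 * p ≤ j ∧ j ≤ n

namespace Strategy

variable (s : Strategy)

/-- Nodes above level `e`, and leaves of level `e`, earn at most `2 * e`. -/
lemma inRegion_of_credit {e i : ℕ} (h1 : 2 * 2 ^ e ≤ i)
    (hc : 2 * e + 1 ≤ s.credit i) : InRegion (2 ^ e) i (s.move i) := by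
  have hp : 1 ≤ 2 ^ e := Nat.one_le_two_pow
  have hk1 := s.one_le_move (n := i) (by omega)
  have hk := s.move_le (n := i) (by omega)
  have key := credit_add (s.isHeap (n := i) (by omega)) hk1 hk (by omega)
  have hc' : 2 * e + 1 ≤ PullDowns.credit i (s.heap i) (s.move i) := hc
  have hl1 := Nat.pow_log_le_self 2 (x := s.move i) (by omega)
  have hnc := numChildren_le i (s.move i)
  rcases lt_trichotomy (Nat.log 2 (s.move i)) e with hlt | heq | hgt
  · omega
  · rw [heq] at hl1 key
    left
    simp only [numChildren] at key
    split_ifs at key <;> omega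
  · right
    have : 2 ^ (e + 1) ≤ 2 ^ Nat.log 2 (s.move i) := Nat.pow_le_pow_right (by norm_num) hgt
    rw [pow_succ] at this
    omega

lemma inRegion_of_loss_eq_zero {e i : ℕ} (h1 : 2 * 2 ^ e ≤ i) (h2 : i < 4 * 2 ^ e)
    (h : s.loss i = 0) : InRegion (2 ^ e) i (s.move i) := by
  apply s.inRegion_of_credit h1
  rw [s.loss_eq (E := e + 1) (by omega) (by rw [pow_succ]; omega)
    (by rw [pow_succ, pow_succ]; omega), maxCredit] at h
  split_ifs at h <;> omega

/-- The case `i = 2 * 2 ^ e` must be excluded: there the maximal credit is smaller by one, so a loss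
of one already permits leaving the region. -/
lemma inRegion_of_loss_le_one {e i : ℕ} (h1 : 2 * 2 ^ e < i) (h2 : i < 4 * 2 ^ e)
    (h : s.loss i ≤ 1) : InRegion (2 ^ e) i (s.move i) := by
  apply s.inRegion_of_credit h1.le
  rw [s.loss_eq (E := e + 1) (by omega) (by rw [pow_succ]; omega)
    (by rw [pow_succ, pow_succ]; omega), maxCredit, if_neg (by rw [pow_succ]; omega)] at h
  omega

/-- A move without loss on a heap with an only child moves neither this child nor its parent. -/
lemma move_ne_of_loss_eq_zero {e m : ℕ} (h1 : 2 ^ e < m) (h2 : m < 2 * 2 ^ e)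
    (h : s.loss (2 * m) = 0) : s.move (2 * m) ≠ 2 * m ∧ s.move (2 * m) ≠ m := by
  have hp : 1 ≤ 2 ^ e := Nat.one_le_two_pow
  have hk1 := s.one_le_move (n := 2 * m) (by omega)
  have hk := s.move_le (n := 2 * m) (by omega)
  have key := credit_add (s.isHeap (n := 2 * m) (by omega)) hk1 hk (by omega)
  rw [s.loss_eq (E := e + 1) (by omega) (by rw [pow_succ]; omega)
    (by rw [pow_succ, pow_succ]; omega), maxCredit, if_neg (by rw [pow_succ]; omega)] at h
  have hc : s.credit (2 * m) = PullDowns.credit (2 * m) (s.heap (2 * m)) (s.move (2 * m)) := rfl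
  rw [← hc] at key
  constructor
  · intro hm
    have hlog : Nat.log 2 (2 * m) = e + 1 :=
      (Nat.log_eq_iff (by omega)).2 ⟨by rw [pow_succ]; omega, by rw [pow_succ, pow_succ]; omega⟩
    rw [hm, hlog] at key
    simp only [numChildren, dvd_mul_right, and_self, if_true] at key
    split_ifs at key <;> omega
  · intro hm
    have hlog : Nat.log 2 m = e :=
      (Nat.log_eq_iff (by omega)).2 ⟨by omega, by rw [pow_succ]; omega⟩
    rw [hm, hlog] at key
    simp only [numChildren] at key
    split_ifs at key <;> omega

lemma not_onPath_leaf {p n j k : ℕ} (h : InRegion p n k) (h1 : n < 2 * j) (h2 : j < 2 * p) :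
    ¬ OnPath k j := by
  intro hp
  rcases hp.eq_or_two_mul_le with rfl | h3
  · rcases h with h | h <;> omega
  · rcases h with h | h <;> omega

/-- As long as the moves stay in the region, the values less than `w` in the region are among
those that it has at the beginning, if the leaves that it absorbs and the parents of the nodes
of its upper level are at least `w`. -/
lemma region_values {p n₀ n₁ w : ℕ} {S : Set ℕ} (hp : 2 ≤ p) (h0 : 2 * p ≤ n₀) (h01 : n₀ ≤ n₁)
    (h1 : n₁ < 4 * p) (hk : ∀ i, n₀ ≤ i → i < n₁ → InRegion p i (s.move i))
    (hleaf : ∀ j, n₀ < 2 * j → 2 * j ≤ n₁ → w ≤ s.heap n₀ j)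
    (hpar : ∀ j, p ≤ j → 2 * j ≤ n₁ → w ≤ s.heap n₀ (j / 2))
    (hS : ∀ j, InRegion p n₀ j → s.heap n₀ j < w → s.heap n₀ j ∈ S) :
    (∀ j, InRegion p n₁ j → s.heap n₁ j < w → s.heap n₁ j ∈ S) ∧
      ∀ j, n₁ ≤ 2 * j → j < 2 * p → s.heap n₁ j = s.heap n₀ j := by
  induction n₁, h01 using Nat.le_induction with
  | base => exact ⟨hS, fun _ _ _ => rfl⟩
  | succ n hn ih =>
    obtain ⟨ih1, ih2⟩ := ih (by omega) (fun i hi hi' => hk i hi (by omega))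
      (fun j hj hj' => hleaf j hj (by omega)) (fun j hj hj' => hpar j hj (by omega))
    have hkn := hk n hn (by omega)
    constructor
    · intro j hj hjw
      by_cases hj1 : j = n + 1
      · rw [hj1, s.heap_succ_last (by omega)] at hjw ⊢
        exact ih1 _ hkn hjw
      · have hjn : j ≤ n := by rcases hj with h | h <;> omega
        have hj2 : 2 ≤ j := by rcases hj with h | h <;> omega
        by_cases hpath : OnPath (s.move n) j
        · rw [s.heap_succ_onPath hj2 hjn hpath] at hjw ⊢
          -- On the upper level the demoted value comes from above the region and is at least `w`;
          -- on the lower level it comes from a parent inside the region.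
          rcases hj with hj | hj
          · have h1 := hpar j hj.1 hj.2
            have h2 := s.heap_mono (n := n₀) (m := n) (j := j / 2) (by omega) (by omega) hn
            omega
          · exact ih1 _ (Or.inl ⟨by omega, by omega⟩) hjw
        · rw [s.heap_succ_not_onPath hj2 hjn hpath] at hjw ⊢
          -- The index that has just joined the region was an untouched leaf, so it still holds its
          -- initial value, at least `w`.
          by_cases hnew : 2 * j = n + 1
          · rw [ih2 j (by omega) (by omega)] at hjw
            have := hleaf j (by omega) hnew.le
            omega
          · refine ih1 _ ?_ hjw
            rcases hj with h | h
            · exact Or.inl (by omega)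
            · exact Or.inr (by omega)
    · intro j hj hj'
      rw [s.heap_succ_not_onPath (by omega) (by omega)
        (not_onPath_leaf hkn (by omega) hj'), ih2 j (by omega) hj']

/-- If the first three moves at a new level incur no loss, then the first node of this level is
at least `4`. -/
lemma four_le_of_three_loss_eq_zero {e : ℕ} (he : 1 ≤ e)
    (h0 : s.loss (2 * 2 ^ e) = 0) (h1 : s.loss (2 * 2 ^ e + 1) = 0)
    (h2 : s.loss (2 * 2 ^ e + 2) = 0) : 4 ≤ s.heap (2 * 2 ^ e + 3) (2 * 2 ^ e) := by
  have hp : 2 ≤ 2 ^ e := Nat.pow_le_pow_right (n := 2) (by norm_num) he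
  have hpe : 2 ∣ 2 ^ e := dvd_pow_self 2 (by omega)
  have hR0 := s.inRegion_of_loss_eq_zero (e := e) le_rfl (by omega) h0
  have hR1 := s.inRegion_of_loss_eq_zero (e := e) (by omega) (by omega) h1
  have hR2 := s.inRegion_of_loss_eq_zero (e := e) (by omega) (by omega) h2
  have hR2' := s.move_ne_of_loss_eq_zero (e := e) (m := 2 ^ e + 1) (by omega) (by omega)
    (by rw [← h2]; ring_nf)
  rw [show 2 * (2 ^ e + 1) = 2 * 2 ^ e + 2 by ring] at hR2'
  generalize 2 ^ e = p at *
  have hH := s.isHeap (n := 2 * p) (by omega)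
  have hH3 := s.isHeap (n := 2 * p + 3) (by omega)
  have hw : s.heap (2 * p) (p + 1) < s.heap (2 * p) (p / 2) := by
    have := hH.decreasing (p + 1) (by omega) (by omega)
    rwa [show (p + 1) / 2 = p / 2 by omega] at this
  -- Initially the region is just `p` and `2 * p`; the only leaf absorbed is `p + 1`, whose value
  -- serves as `w`.
  have key := s.region_values (p := p) (n₀ := 2 * p) (n₁ := 2 * p + 3)
    (w := s.heap (2 * p) (p + 1)) (S := {s.heap (2 * p) p, s.heap (2 * p) (2 * p)}) hp le_rfl
    (by omega) (by omega)
    (by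
      intro i hi hi'
      obtain rfl | rfl | rfl : i = 2 * p ∨ i = 2 * p + 1 ∨ i = 2 * p + 2 := by omega
      exacts [hR0, hR1, hR2])
    (by
      intro j hj hj'
      obtain rfl : j = p + 1 := by omega
      exact le_rfl)
    (by
      intro j hj hj'
      rw [show j / 2 = p / 2 by omega]
      exact hw.le)
    (by
      intro j hj _
      obtain rfl | rfl : j = p ∨ j = 2 * p := by rcases hj with h | h <;> omega
      · exact Or.inl rfl
      · exact Or.inr rfl)
  -- During the first two moves `p + 1` is a leaf of the upper level; the third, being lossless,
  -- avoids `p + 1` and its only child.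
  have hstay : s.heap (2 * p + 3) (p + 1) = s.heap (2 * p) (p + 1) := by
    rw [s.heap_succ_not_onPath (n := 2 * p + 2) (by omega) (by omega),
      s.heap_succ_not_onPath (n := 2 * p + 1) (by omega) (by omega),
      s.heap_succ_not_onPath (n := 2 * p) (by omega) (by omega)]
    · exact not_onPath_leaf hR0 (by omega) (by omega)
    · exact not_onPath_leaf hR1 (by omega) (by omega)
    · intro h
      rcases h.eq_or_two_mul_le with h3 | h3 <;> rcases hR2 with h4 | h4 <;> omega
  have hx := hH3.decreasing (2 * p + 2) (by omega) (by omega)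
  have hy := hH3.decreasing (2 * p + 3) (by omega) (by omega)
  rw [show (2 * p + 2) / 2 = p + 1 by omega, hstay] at hx
  rw [show (2 * p + 3) / 2 = p + 1 by omega, hstay] at hy
  have hxS := key.1 (2 * p + 2) (Or.inr (by omega)) hx
  have hyS := key.1 (2 * p + 3) (Or.inr (by omega)) hy
  have hzS := key.1 (2 * p) (Or.inr (by omega))
  have hxy := hH3.ne (a := 2 * p + 2) (b := 2 * p + 3) (by omega) (by omega) (by omega) (by omega)
    (by omega)
  have hxz := hH3.ne (a := 2 * p + 2) (b := 2 * p) (by omega) (by omega) (by omega) (by omega)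
    (by omega)
  have hyz := hH3.ne (a := 2 * p + 3) (b := 2 * p) (by omega) (by omega) (by omega) (by omega)
    (by omega)
  have hwz := hH3.ne (a := p + 1) (b := 2 * p) (by omega) (by omega) (by omega) (by omega)
    (by omega)
  have hx1 := hH3.pos (j := 2 * p + 2) (by omega) (by omega)
  have hy1 := hH3.pos (j := 2 * p + 3) (by omega) (by omega)
  rw [hstay] at hwz
  simp only [Set.mem_insert_iff, Set.mem_singleton_iff] at hxS hyS hzS
  -- The two children of `p + 1` use up both values of `S`. So the node at `2 * p` exceeds `w`,
  -- which in turn exceeds two distinct positive values.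
  by_contra hlt
  have hzw : s.heap (2 * p + 3) (2 * p) < s.heap (2 * p) (p + 1) := by omega
  have := hzS hzw
  omega

/-- The obstruction to a level without loss: `p` is the first index of the last level of the heap
on `2 * p - 3` nodes. -/
def Obstructed (p : ℕ) : Prop :=
  4 ≤ s.heap (2 * p - 3) p ∨ s.heap (2 * p - 3) (p - 1) ≤ 3

variable {s}

/-! ### An obstructed level costs a credit and passes the obstruction on. -/

/-- If the last leaf above the level holds at most 3 and stays while it acquires two children, then
it holds 3 and they hold 1 and 2, which leaves at least 4 for the first node of the level. -/
lemma Obstructed.four_le {e : ℕ} (he : 2 ≤ e) (h : s.Obstructed (2 ^ e))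
    (h3 : s.loss (2 * 2 ^ e - 3) = 0) (h2 : s.loss (2 * 2 ^ e - 2) = 0) :
    4 ≤ s.heap (2 * 2 ^ e) (2 ^ e) := by
  obtain ⟨f, rfl⟩ : ∃ f, e = f + 1 := ⟨e - 1, by omega⟩
  have hq : 2 ≤ 2 ^ f := Nat.pow_le_pow_right (n := 2) (by norm_num) (show 1 ≤ f by omega)
  rw [Obstructed] at h
  rw [pow_succ] at *
  have hR3 := s.inRegion_of_loss_eq_zero (e := f) (by omega) (by omega) h3
  have hR2 := s.inRegion_of_loss_eq_zero (e := f) (by omega) (by omega) h2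
  have hR2' := s.move_ne_of_loss_eq_zero (e := f) (m := 2 * 2 ^ f - 1) (by omega) (by omega)
    (by rw [← h2]; congr 1; omega)
  rw [show 2 * (2 * 2 ^ f - 1) = 4 * 2 ^ f - 2 by omega] at hR2'
  generalize 2 ^ f = q at *
  rw [show 2 * (q * 2) = 4 * q by ring, show q * 2 = 2 * q by ring] at *
  by_contra hlt
  have hm3 := s.heap_mono (n := 4 * q - 3) (m := 4 * q) (j := 2 * q) (by omega) (by omega)
    (by omega)
  have hm1 := s.heap_mono (n := 4 * q - 1) (m := 4 * q) (j := 2 * q) (by omega) (by omega)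
    (by omega)
  have hu : s.heap (4 * q - 3) (2 * q - 1) ≤ 3 := h.resolve_left (by omega)
  have hH := s.isHeap (n := 4 * q - 1) (by omega)
  have hstay : s.heap (4 * q - 1) (2 * q - 1) = s.heap (4 * q - 3) (2 * q - 1) := by
    have e1 : s.heap (4 * q - 2 + 1) (2 * q - 1) = s.heap (4 * q - 2) (2 * q - 1) :=
      s.heap_succ_not_onPath (by omega) (by omega) (by
        intro h
        rcases h.eq_or_two_mul_le with h3 | h3 <;> rcases hR2 with h4 | h4 <;> omega)
    have e2 : s.heap (4 * q - 3 + 1) (2 * q - 1) = s.heap (4 * q - 3) (2 * q - 1) :=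
      s.heap_succ_not_onPath (by omega) (by omega) (not_onPath_leaf hR3 (by omega) (by omega))
    rw [show 4 * q - 2 + 1 = 4 * q - 1 by omega] at e1
    rw [show 4 * q - 3 + 1 = 4 * q - 2 by omega] at e2
    rw [e1, e2]
  have ha := hH.decreasing (4 * q - 2) (by omega) (by omega)
  have hb := hH.decreasing (4 * q - 1) (by omega) (by omega)
  rw [show (4 * q - 2) / 2 = 2 * q - 1 by omega] at ha
  rw [show (4 * q - 1) / 2 = 2 * q - 1 by omega] at hb
  have hab := hH.ne (a := 4 * q - 2) (b := 4 * q - 1) (by omega) (by omega) (by omega) (by omega)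
    (by omega)
  have hap := hH.ne (a := 4 * q - 2) (b := 2 * q) (by omega) (by omega) (by omega) (by omega)
    (by omega)
  have hbp := hH.ne (a := 4 * q - 1) (b := 2 * q) (by omega) (by omega) (by omega) (by omega)
    (by omega)
  have hup := hH.ne (a := 2 * q - 1) (b := 2 * q) (by omega) (by omega) (by omega) (by omega)
    (by omega)
  have ha1 := hH.pos (j := 4 * q - 2) (by omega) (by omega)
  have hb1 := hH.pos (j := 4 * q - 1) (by omega) (by omega)
  have hp1 := hH.pos (j := 2 * q) (by omega) (by omega)
  omega

end Strategy

/-- If the values at the indices from `p` to `2 * p - 2` are at least `w`, then so are those at the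
indices below `p`. -/
lemma IsHeap.le_of_leaves {n p w : ℕ} {H : ℕ → ℕ} (hH : IsHeap n H) (hn : 2 * p ≤ n)
    (hw : ∀ j, p ≤ j → j ≤ 2 * p - 2 → w ≤ H j) :
    ∀ j, 1 ≤ j → j ≤ 2 * p - 2 → w ≤ H j := by
  intro j
  induction hd : 2 * p - j using Nat.strong_induction_on generalizing j with
  | _ d ih =>
    intro h1 h2
    by_cases hj : p ≤ j
    · exact hw j hj h2
    · have h3 := ih (2 * p - 2 * j) (by omega) (2 * j) rfl (by omega) (by omega)
      have h4 := hH.decreasing (2 * j) (by omega) (by omega)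
      rw [show 2 * j / 2 = j by omega] at h4
      omega

namespace Strategy

variable {s : Strategy}

/-- No value below that of `m`, the smallest of the leaves considered, can enter the region later.
When `m` acquires children they are smaller than `m`, so they come from the initial values `S` of
the lower level. -/
lemma drop_values {p m n₀ : ℕ} {S : Set ℕ} (hp : 4 ≤ p) (h0 : 2 * p ≤ n₀)
    (h0' : n₀ ≤ 2 * p + 1) (h4 : 4 ≤ s.heap n₀ p) (hm : p + 1 ≤ m) (hm' : m ≤ 2 * p - 2)
    (hw : s.heap n₀ m ≤ 3)
    (hmin : ∀ j, p + 1 ≤ j → j ≤ 2 * p - 2 → s.heap n₀ m ≤ s.heap n₀ j)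
    (hk : ∀ i, n₀ ≤ i → i ≤ 4 * p - 4 → InRegion p i (s.move i))
    (hS : ∀ j, 2 * p ≤ j → j ≤ n₀ → s.heap n₀ j ∈ S) :
    s.heap (2 * m) (2 * m) ∈ S ∧ (s.move (2 * m) ≠ 2 * m ∧ s.move (2 * m) ≠ m →
      s.heap (2 * m + 1) (2 * m) ∈ S ∧ s.heap (2 * m + 1) (2 * m + 1) ∈ S) := by
  have hlow : ∀ j, 1 ≤ j → j ≤ 2 * p - 2 → s.heap n₀ m ≤ s.heap n₀ j :=
    (s.isHeap (n := n₀) (by omega)).le_of_leaves h0 fun j hj hj' => by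
      rcases hj.eq_or_lt with rfl | hj
      · omega
      · exact hmin j hj hj'
  have key : ∀ n₁, n₀ ≤ n₁ → n₁ ≤ 2 * m + 1 → _ := fun n₁ h01 h1 =>
    s.region_values (p := p) (n₀ := n₀) (n₁ := n₁) (w := s.heap n₀ m) (S := S) (by omega) h0 h01
      (by omega) (fun i hi hi' => hk i hi (by omega))
      (fun j hj hj' => hlow j (by omega) (by omega))
      (fun j hj hj' => hlow (j / 2) (by omega) (by omega))
      (fun j hj hjw => by
        rcases hj with hj | hj
        · have : j = p := by omega
          subst this
          omega
        · exact hS j hj.1 hj.2)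
  have hleaf := (key (2 * m) (by omega) (by omega)).2 m le_rfl (by omega)
  constructor
  · refine (key (2 * m) (by omega) (by omega)).1 _ (Or.inr (by omega)) ?_
    have := (s.isHeap (n := 2 * m) (by omega)).decreasing (2 * m) (by omega) le_rfl
    rwa [show 2 * m / 2 = m by omega, hleaf] at this
  · rintro ⟨hne1, hne2⟩
    have hstay : s.heap (2 * m + 1) m = s.heap n₀ m := by
      rw [s.heap_succ_not_onPath (by omega) (by omega), hleaf]
      intro h
      have := s.move_le (n := 2 * m) (by omega)
      rcases h.eq_or_two_mul_le with h3 | h3 <;> omega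
    have hH := s.isHeap (n := 2 * m + 1) (by omega)
    have hx := hH.decreasing (2 * m) (by omega) (by omega)
    have hy := hH.decreasing (2 * m + 1) (by omega) (by omega)
    rw [show 2 * m / 2 = m by omega, hstay] at hx
    rw [show (2 * m + 1) / 2 = m by omega, hstay] at hy
    exact ⟨(key (2 * m + 1) (by omega) le_rfl).1 _ (Or.inr (by omega)) hx,
      (key (2 * m + 1) (by omega) le_rfl).1 _ (Or.inr (by omega)) hy⟩

lemma exists_min_leaf_or {p n₀ : ℕ} (hp : 4 ≤ p) (h0 : 2 * p ≤ n₀) (h4 : 4 ≤ s.heap n₀ p) :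
    (∃ m, p + 1 ≤ m ∧ m ≤ 2 * p - 2 ∧ s.heap n₀ m ≤ 3 ∧
      ∀ j, p + 1 ≤ j → j ≤ 2 * p - 2 → s.heap n₀ m ≤ s.heap n₀ j) ∨
    ∀ j, 1 ≤ j → j ≤ n₀ → s.heap n₀ j ≤ 3 → 2 * p - 1 ≤ j := by
  obtain ⟨m, hm, hmin⟩ := Finset.exists_min_image (Finset.Icc (p + 1) (2 * p - 2)) (s.heap n₀)
    ⟨p + 1, Finset.mem_Icc.2 ⟨le_rfl, by omega⟩⟩
  rw [Finset.mem_Icc] at hm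
  by_cases hw : s.heap n₀ m ≤ 3
  · exact Or.inl ⟨m, hm.1, hm.2, hw, fun j hj hj' => hmin j (Finset.mem_Icc.2 ⟨hj, hj'⟩)⟩
  · right
    intro j h1 _ hj
    by_contra hlt
    have := (s.isHeap (n := n₀) (by omega)).le_of_leaves h0 (w := 4) (fun i hi hi' => by
      rcases hi.eq_or_lt with rfl | hi
      · exact h4
      · have := hmin i (Finset.mem_Icc.2 ⟨hi, hi'⟩)
        omega) j h1 (by omega)
    omega

/-- Otherwise 1, 2 and 3 would have to share the two indices `2 * p - 1` and `2 * p`. -/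
lemma exists_min_leaf {p : ℕ} (hp : 4 ≤ p) (h4 : 4 ≤ s.heap (2 * p) p) :
    ∃ m, p + 1 ≤ m ∧ m ≤ 2 * p - 2 ∧ s.heap (2 * p) m ≤ 3 ∧
      ∀ j, p + 1 ≤ j → j ≤ 2 * p - 2 → s.heap (2 * p) m ≤ s.heap (2 * p) j := by
  refine (exists_min_leaf_or hp le_rfl h4).resolve_right fun h => ?_
  have hH := s.isHeap (n := 2 * p) (by omega)
  obtain ⟨a, ha, ha', ea⟩ := hH.exists_eq (v := 1) le_rfl (by omega)
  obtain ⟨b, hb, hb', eb⟩ := hH.exists_eq (v := 2) (by omega) (by omega)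
  obtain ⟨c, hc, hc', ec⟩ := hH.exists_eq (v := 3) (by omega) (by omega)
  have h1 := h a ha ha' (by omega)
  have h2 := h b hb hb' (by omega)
  have h3 := h c hc hc' (by omega)
  have hab : a ≠ b := by
    rintro rfl
    omega
  have hac : a ≠ c := by
    rintro rfl
    omega
  have hbc : b ≠ c := by
    rintro rfl
    omega
  omega

/-- A move through `2 * p` would demote the value at `p`, at least 4, into it, and the value at an
index never decreases afterwards. -/
lemma first_node_stays {p n₀ n : ℕ} (hp : 2 ≤ p) (h0 : 2 * p ≤ n₀) (h4 : 4 ≤ s.heap n₀ p)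
    (hz : s.heap (4 * p - 3) (2 * p) ≤ 3) (hn : n₀ ≤ n) (hn' : n ≤ 4 * p - 3) :
    s.heap n (2 * p) = s.heap n₀ (2 * p) := by
  induction n, hn using Nat.le_induction with
  | base => rfl
  | succ n hn ih =>
    rw [← ih (by omega)]
    apply s.heap_succ_not_onPath (by omega) (by omega)
    intro h
    have h1 := s.heap_succ_onPath (by omega) (by omega) h
    have h2 := s.heap_mono (n := n₀) (m := n) (j := p) (by omega) (by omega) hn
    have h3 := s.heap_mono (n := n + 1) (m := 4 * p - 3) (j := 2 * p) (by omega) (by omega) hn'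
    rw [show 2 * p / 2 = p by omega] at h1
    omega

/-- Without loss, both children of the smallest leaf `m` would carry the single value initially at
`2 * p`, where `p = 2 ^ e`. -/
lemma Obstructed.exists_loss {e : ℕ} (he : 2 ≤ e) (h : s.Obstructed (2 ^ e))
    (hl : ∀ i, 2 * 2 ^ e - 3 ≤ i → i ≤ 4 * 2 ^ e - 4 → s.loss i = 0) : False := by
  have hp : 4 ≤ 2 ^ e := Nat.pow_le_pow_right (n := 2) (by norm_num) he
  have h4 := h.four_le he (hl _ (by omega) (by omega)) (hl _ (by omega) (by omega))
  obtain ⟨m, hm, hm', hw, hmin⟩ := exists_min_leaf hp h4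
  have hdrop := (drop_values (S := {s.heap (2 * 2 ^ e) (2 * 2 ^ e)}) hp le_rfl (by omega) h4
    hm hm' hw hmin
    (fun i hi hi' => s.inRegion_of_loss_eq_zero hi (by omega) (hl i (by omega) hi'))
    (fun j hj hj' => by rw [le_antisymm hj' hj]; rfl)).2
    (s.move_ne_of_loss_eq_zero hm (by omega) (hl _ (by omega) (by omega)))
  exact (s.isHeap (n := 2 * m + 1) (by omega)).ne (by omega) (by omega) (by omega) le_rfl
    (show 2 * m ≠ 2 * m + 1 by omega) (hdrop.1.trans hdrop.2.symm)

lemma obstructed_of_three_loss_eq_zero {e : ℕ} (he : 2 ≤ e)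
    (h0 : s.loss (2 * 2 ^ e) = 0) (h1 : s.loss (2 * 2 ^ e + 1) = 0)
    (h2 : s.loss (2 * 2 ^ e + 2) = 0) : s.Obstructed (2 ^ (e + 1)) := by
  have hp : 4 ≤ 2 ^ e := Nat.pow_le_pow_right (n := 2) (by norm_num) he
  left
  rw [show 2 ^ (e + 1) = 2 * 2 ^ e by rw [pow_succ, mul_comm]]
  exact (s.four_le_of_three_loss_eq_zero (by omega) h0 h1 h2).trans
    (s.heap_mono (by omega) (by omega) (by omega))

lemma Obstructed.succ {e : ℕ} (he : 2 ≤ e) (h : s.Obstructed (2 ^ e))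
    (hle : ∀ i, 2 * 2 ^ e - 3 ≤ i → i ≤ 4 * 2 ^ e - 4 → s.loss i ≤ 1)
    (hone : ∀ i j, 2 * 2 ^ e - 3 ≤ i → i ≤ 4 * 2 ^ e - 4 → 2 * 2 ^ e - 3 ≤ j →
      j ≤ 4 * 2 ^ e - 4 → i ≠ j → s.loss i = 0 ∨ s.loss j = 0) :
    s.Obstructed (2 ^ (e + 1)) := by
  have hp : 4 ≤ 2 ^ e := Nat.pow_le_pow_right (n := 2) (by norm_num) he
  -- If the one loss occurs before the level starts, its first three moves are lossless and obstruct
  -- the next level.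
  have hearly : ∀ i, 2 * 2 ^ e - 3 ≤ i → i < 2 * 2 ^ e → s.loss i ≠ 0 →
      s.Obstructed (2 ^ (e + 1)) := fun i hi hi' hne =>
    obstructed_of_three_loss_eq_zero he
      ((hone i _ hi (by omega) (by omega) (by omega) (by omega)).resolve_left hne)
      ((hone i _ hi (by omega) (by omega) (by omega) (by omega)).resolve_left hne)
      ((hone i _ hi (by omega) (by omega) (by omega) (by omega)).resolve_left hne)
  by_cases h3 : s.loss (2 * 2 ^ e - 3) = 0
  swap
  · exact hearly _ le_rfl (by omega) h3
  by_cases h2 : s.loss (2 * 2 ^ e - 2) = 0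
  swap
  · exact hearly _ (by omega) (by omega) h2
  have h4 := h.four_le he h3 h2
  by_contra hob
  rw [Obstructed, show 2 ^ (e + 1) = 2 * 2 ^ e by rw [pow_succ, mul_comm],
    show 2 * (2 * 2 ^ e) = 4 * 2 ^ e by ring, not_or, not_le, not_le] at hob
  obtain ⟨hz, hu⟩ := hob
  -- If all moves stay in the region, the child `2 * m` must carry the value that has never left `2
  -- * 2 ^ e`. Only the move at `2 * 2 ^ e` can leave the region with loss one, and then all later
  -- moves are lossless.
  by_cases hR : InRegion (2 ^ e) (2 * 2 ^ e) (s.move (2 * 2 ^ e))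
  · obtain ⟨m, hm, hm', hw, hmin⟩ := exists_min_leaf hp h4
    have hdrop := (drop_values (S := {s.heap (2 * 2 ^ e) (2 * 2 ^ e)}) hp le_rfl (by omega) h4
      hm hm' hw hmin
      (fun i hi hi' => by
        rcases hi.eq_or_lt with rfl | hi
        · exact hR
        · exact s.inRegion_of_loss_le_one hi (by omega) (hle i (by omega) hi'))
      (fun j hj hj' => by rw [le_antisymm hj' hj]; rfl)).1
    have hstay := first_node_stays (n₀ := 2 * 2 ^ e) (n := 2 * m) (by omega) le_rfl h4 (by omega)
      (by omega) (by omega)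
    exact (s.isHeap (n := 2 * m) (by omega)).ne (by omega) le_rfl (by omega) (by omega)
      (show 2 * m ≠ 2 * 2 ^ e by omega) (hdrop.trans hstay.symm)
  · have hl0 : s.loss (2 * 2 ^ e) ≠ 0 := fun h0 =>
      hR (s.inRegion_of_loss_eq_zero le_rfl (by omega) h0)
    have hl : ∀ i, 2 * 2 ^ e + 1 ≤ i → i ≤ 4 * 2 ^ e - 4 → s.loss i = 0 := fun i hi hi' =>
      (hone _ i (by omega) (by omega) (by omega) hi' (by omega)).resolve_left hl0
    have hk : ∀ i, 2 * 2 ^ e + 1 ≤ i → i ≤ 4 * 2 ^ e - 4 → InRegion (2 ^ e) i (s.move i) :=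
      fun i hi hi' => s.inRegion_of_loss_eq_zero (by omega) (by omega) (hl i hi hi')
    have h4' : 4 ≤ s.heap (2 * 2 ^ e + 1) (2 ^ e) := by
      rw [s.heap_succ_not_onPath (by omega) (by omega)]
      · exact h4
      · intro hpath
        have := s.move_le (n := 2 * 2 ^ e) (by omega)
        rcases hpath.eq_or_two_mul_le with h5 | h5
        · exact hR (Or.inl (by omega))
        · exact hR (Or.inr (by omega))
    -- With one more node on the level, `S` has two values, but one of them never leaves `2 * 2 ^
    -- e`, so two children would share the other. Alternatively 1, 2, 3 occupy the last three
    -- indices, and `2 * 2 ^ e - 1` keeps one of them.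
    rcases exists_min_leaf_or hp (by omega) h4' with ⟨m, hm, hm', hw, hmin⟩ | hsmall
    · have hdrop := (drop_values (S := {s.heap (2 * 2 ^ e + 1) (2 * 2 ^ e),
        s.heap (2 * 2 ^ e + 1) (2 * 2 ^ e + 1)}) hp (by omega) le_rfl h4' hm hm' hw hmin hk
        (fun j hj hj' => by
          rcases hj.eq_or_lt with rfl | hj
          · exact Or.inl rfl
          · rw [le_antisymm hj' hj]
            exact Or.inr rfl)).2
        (s.move_ne_of_loss_eq_zero hm (by omega) (hl _ (by omega) (by omega)))
      have hstay := first_node_stays (n₀ := 2 * 2 ^ e + 1) (n := 2 * m + 1) (by omega) (by omega)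
        h4' (by omega) (by omega) (by omega)
      have hH := s.isHeap (n := 2 * m + 1) (by omega)
      simp only [Set.mem_insert_iff, Set.mem_singleton_iff, ← hstay] at hdrop
      have e1 := hH.ne (a := 2 * m) (b := 2 * 2 ^ e) (by omega) (by omega) (by omega) (by omega)
        (by omega)
      have e2 := hH.ne (a := 2 * m + 1) (b := 2 * 2 ^ e) (by omega) (by omega) (by omega)
        (by omega) (by omega)
      have e3 := hH.ne (a := 2 * m) (b := 2 * m + 1) (by omega) (by omega) (by omega) (by omega)
        (by omega)
      omega
    · have hH := s.isHeap (n := 2 * 2 ^ e + 1) (by omega)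
      obtain ⟨a, ha, ha', ea⟩ := hH.exists_eq (v := 1) le_rfl (by omega)
      obtain ⟨b, hb, hb', eb⟩ := hH.exists_eq (v := 2) (by omega) (by omega)
      obtain ⟨c, hc, hc', ec⟩ := hH.exists_eq (v := 3) (by omega) (by omega)
      have i1 := hsmall a ha ha' (by omega)
      have i2 := hsmall b hb hb' (by omega)
      have i3 := hsmall c hc hc' (by omega)
      have hab : a ≠ b := by
        rintro rfl
        omega
      have hac : a ≠ c := by
        rintro rfl
        omega
      have hbc : b ≠ c := by
        rintro rfl
        omega
      have hlast : s.heap (2 * 2 ^ e + 1) (2 * 2 ^ e - 1) ≤ 3 := by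
        obtain h5 | h5 | h5 : a = 2 * 2 ^ e - 1 ∨ b = 2 * 2 ^ e - 1 ∨ c = 2 * 2 ^ e - 1 := by
          omega
        · rw [← h5]; omega
        · rw [← h5]; omega
        · rw [← h5]; omega
      -- Only the persistence of leaves is needed, so `w = 0` and `S = ∅` make the other conclusion
      -- vacuous.
      have hstay := (s.region_values (p := 2 ^ e) (n₀ := 2 * 2 ^ e + 1) (n₁ := 4 * 2 ^ e - 3)
        (w := 0) (S := ∅) (by omega) (by omega) (by omega) (by omega)
        (fun i hi hi' => hk i hi (by omega)) (fun _ _ _ => Nat.zero_le _)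
        (fun _ _ _ => Nat.zero_le _) (fun _ _ h => absurd h (Nat.not_lt_zero _))).2
        (2 * 2 ^ e - 1) (by omega) (by omega)
      omega

/-- On four nodes the value at 3 is below the root, hence at most 3, and a lossless move leaves this
leaf alone. -/
lemma obstructed_four (h : s.loss 4 = 0) : s.Obstructed (2 ^ 2) := by
  right
  have hR := s.inRegion_of_loss_eq_zero (e := 1) (by norm_num) (by norm_num) h
  change s.heap 5 3 ≤ 3
  have h4 := s.isHeap (n := 4) (by norm_num)
  rw [s.heap_succ_not_onPath (n := 4) (by norm_num) (by norm_num)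
    (not_onPath_leaf hR (by norm_num) (by norm_num))]
  have h1 := h4.decreasing 3 (by norm_num) (by norm_num)
  have h2 := h4.le (j := 1) le_rfl (by norm_num)
  norm_num at h1
  omega

variable (s) in
lemma sum_loss_window (e : ℕ) (he : 2 ≤ e) :
    ((e : ℤ) - 2 ≤ ∑ i ∈ Finset.Icc 2 (2 * 2 ^ e - 4), s.loss i) ∧
    (∑ i ∈ Finset.Icc 2 (2 * 2 ^ e - 4), s.loss i = (e : ℤ) - 2 → s.Obstructed (2 ^ e)) := by
  induction e, he using Nat.le_induction with
  | base =>
    refine ⟨Finset.sum_nonneg fun i hi => s.loss_nonneg (Finset.mem_Icc.1 hi).1, fun h => ?_⟩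
    refine obstructed_four ?_
    have := (Finset.sum_eq_zero_iff_of_nonneg fun i hi =>
      s.loss_nonneg (Finset.mem_Icc.1 hi).1).1 (h.trans (by norm_num))
    exact this 4 (by simp)
  | succ e he ih =>
    have hp : 4 ≤ 2 ^ e := Nat.pow_le_pow_right (n := 2) (by norm_num) he
    obtain ⟨ih1, ih2⟩ := ih
    have hsplit : ∑ i ∈ Finset.Icc 2 (2 * 2 ^ (e + 1) - 4), s.loss i
        = ∑ i ∈ Finset.Icc 2 (2 * 2 ^ e - 4), s.loss i
          + ∑ i ∈ Finset.Icc (2 * 2 ^ e - 3) (4 * 2 ^ e - 4), s.loss i := by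
      rw [← Finset.sum_union]
      · congr 1
        ext i
        simp only [Finset.mem_union, Finset.mem_Icc, pow_succ]
        omega
      · rw [Finset.disjoint_left]
        intro i
        simp only [Finset.mem_Icc]
        omega
    have hnn : ∀ i ∈ Finset.Icc (2 * 2 ^ e - 3) (4 * 2 ^ e - 4), 0 ≤ s.loss i := fun i hi =>
      s.loss_nonneg (by have := (Finset.mem_Icc.1 hi).1; omega)
    have hw := Finset.sum_nonneg hnn
    have hzero : ∑ i ∈ Finset.Icc (2 * 2 ^ e - 3) (4 * 2 ^ e - 4), s.loss i = 0 →
        ∀ i, 2 * 2 ^ e - 3 ≤ i → i ≤ 4 * 2 ^ e - 4 → s.loss i = 0 := fun h i hi hi' =>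
      (Finset.sum_eq_zero_iff_of_nonneg hnn).1 h i (Finset.mem_Icc.2 ⟨hi, hi'⟩)
    rw [hsplit]
    push_cast
    by_cases heq : ∑ i ∈ Finset.Icc 2 (2 * 2 ^ e - 4), s.loss i = (e : ℤ) - 2
    · have hob := ih2 heq
      have hne : ∑ i ∈ Finset.Icc (2 * 2 ^ e - 3) (4 * 2 ^ e - 4), s.loss i ≠ 0 := fun h =>
        hob.exists_loss he (hzero h)
      refine ⟨by omega, fun h => hob.succ he ?_ ?_⟩
      · intro i hi hi'
        have := Finset.single_le_sum hnn (Finset.mem_Icc.2 ⟨hi, hi'⟩)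
        omega
      · intro i j hi hi' hj hj' hij
        by_contra hc
        rw [not_or] at hc
        have h1 := hnn i (Finset.mem_Icc.2 ⟨hi, hi'⟩)
        have h2 := hnn j (Finset.mem_Icc.2 ⟨hj, hj'⟩)
        have hsub : ({i, j} : Finset ℕ) ⊆ Finset.Icc (2 * 2 ^ e - 3) (4 * 2 ^ e - 4) := by
          intro x hx
          rw [Finset.mem_insert, Finset.mem_singleton] at hx
          rw [Finset.mem_Icc]
          omega
        have h3 := Finset.sum_le_sum_of_subset_of_nonneg hsub fun x hx _ => hnn x hx
        rw [Finset.sum_pair hij] at h3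
        omega
    -- A strategy above the bound can meet the next bound only by a lossless window, whose three
    -- moves at the start of the level create the obstruction.
    · refine ⟨by omega, fun h => ?_⟩
      have h0 := hzero (by omega)
      exact obstructed_of_three_loss_eq_zero he (h0 _ (by omega) (by omega))
        (h0 _ (by omega) (by omega)) (h0 _ (by omega) (by omega))

end Strategy

/-! ### The delayed loss and the lower bound. -/

lemma sum_delayedLoss {M : ℕ} (hM : 1 ≤ M) :
    ∑ i ∈ Finset.Icc 2 M, delayedLoss i = ((max (Nat.log 2 (M + 4)) 3 : ℕ) : ℤ) - 3 := by
  induction M, hM using Nat.le_induction with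
  | base =>
    have : Nat.log 2 5 = 2 := (Nat.log_eq_iff (by norm_num)).2 (by norm_num)
    simp [this]
  | succ M hM ih =>
    rw [Finset.sum_Icc_succ_top (by omega), ih]
    have hl1 := Nat.pow_log_le_self 2 (x := M + 4) (by omega)
    have hl2 := Nat.lt_pow_succ_log_self (b := 2) (by norm_num) (M + 4)
    have hL2 : 2 ≤ Nat.log 2 (M + 4) := (Nat.le_log_iff_pow_le (by norm_num) (by omega)).2 (by omega)
    obtain ⟨l, hl⟩ : ∃ l, l = Nat.log 2 (M + 4) := ⟨_, rfl⟩
    rw [← hl] at hl1 hl2 hL2 ⊢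
    by_cases hpow : M + 5 = 2 ^ (l + 1)
    · have h5 : Nat.log 2 (M + 1 + 4) = l + 1 :=
        (Nat.log_eq_iff (by omega)).2 ⟨by omega, by rw [pow_succ 2 (l + 1)]; omega⟩
      rw [h5]
      -- The index `4 = 2 ^ 3 - 4` has ceiling logarithm 2 rather than 3, so it contributes nothing;
      -- this is the source of the maximum with 3.
      by_cases h3 : l = 2
      · subst h3
        have : M = 3 := by omega
        subst this
        have : Nat.clog 2 4 = 2 := Nat.clog_pow 2 2 (by norm_num)
        norm_num [delayedLoss, this]
      · have h8 : 2 ^ 3 ≤ 2 ^ l := Nat.pow_le_pow_right (by norm_num) (by omega)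
        have hc : Nat.clog 2 (M + 1) = l + 1 := by
          rw [pow_succ] at hpow
          refine le_antisymm ((Nat.clog_le_iff_le_pow (by norm_num)).2 (by rw [pow_succ]; omega)) ?_
          exact (Nat.lt_clog_iff_pow_lt (by norm_num)).2 (by omega)
        have : delayedLoss (M + 1) = 1 := by
          rw [delayedLoss, hc, if_pos]
          have : ((M + 5 : ℕ) : ℤ) = ((2 ^ (l + 1) : ℕ) : ℤ) := by rw [hpow]
          push_cast at this ⊢
          rw [← this]
          ring
        rw [this]
        omega
    · have h5 : Nat.log 2 (M + 1 + 4) = l :=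
        (Nat.log_eq_iff (by omega)).2 ⟨by omega, by omega⟩
      have : delayedLoss (M + 1) = 0 := by
        rw [delayedLoss, if_neg]
        intro h
        apply hpow
        have h6 : ((M + 5 : ℕ) : ℤ) = ((2 ^ Nat.clog 2 (M + 1) : ℕ) : ℤ) := by
          push_cast at h ⊢
          linarith
        have h7 : M + 5 = 2 ^ Nat.clog 2 (M + 1) := by exact_mod_cast h6
        have h8 : l < Nat.clog 2 (M + 1) := by
          refine (Nat.pow_lt_pow_iff_right (a := 2) (by norm_num)).1 ?_
          omega
        have h9 : Nat.clog 2 (M + 1) ≤ l + 1 :=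
          (Nat.clog_le_iff_le_pow (by norm_num)).2 (by omega)
        rw [h7, show Nat.clog 2 (M + 1) = l + 1 by omega]
      rw [h5, this, add_zero]

lemma Strategy.sum_delayedLoss_le (s : Strategy) {M : ℕ} (hM : 1 ≤ M) :
    ∑ i ∈ Finset.Icc 2 M, delayedLoss i ≤ ∑ i ∈ Finset.Icc 2 M, s.loss i := by
  rw [sum_delayedLoss hM]
  have hnn : ∀ i ∈ Finset.Icc 2 M, 0 ≤ s.loss i := fun i hi =>
    s.loss_nonneg (Finset.mem_Icc.1 hi).1
  by_cases hl : Nat.log 2 (M + 4) ≤ 3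
  · rw [max_eq_right hl]
    exact (Finset.sum_nonneg hnn).trans' (by norm_num)
  · rw [max_eq_left (by omega)]
    obtain ⟨e, he⟩ : ∃ e, Nat.log 2 (M + 4) = e + 1 := ⟨Nat.log 2 (M + 4) - 1, by omega⟩
    have hl1 := Nat.pow_log_le_self 2 (x := M + 4) (by omega)
    rw [he, pow_succ] at hl1
    have := (s.sum_loss_window e (by omega)).1
    rw [he]
    push_cast
    calc ((e : ℤ) + 1) - 3 = e - 2 := by ring
      _ ≤ _ := this
      _ ≤ _ := Finset.sum_le_sum_of_subset_of_nonneg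
        (Finset.Icc_subset_Icc le_rfl (by omega)) fun i hi _ => hnn i hi

/-! ### Strategies that attain the bound. -/

lemma gameHeap_congr {f g : ℕ → ℕ} {n : ℕ} (hn : 1 ≤ n)
    (h : ∀ i, 1 ≤ i → i < n → f i = g i) : gameHeap f n = gameHeap g n := by
  induction n, hn using Nat.le_induction with
  | base => rfl
  | succ n hn ih =>
    rw [gameHeap_succ f hn, gameHeap_succ g hn, ih fun i h1 h2 => h i h1 (by omega),
      h n hn (by omega)]

lemma validMove_half {i : ℕ} (hi : 1 ≤ i) (H : ℕ → ℕ) : ValidMove i H ((i + 1) / 2) :=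
  ⟨by omega, by omega, le_rfl⟩

/-- The first `n - 1` moves are valid. -/
def ValidUntil (move : ℕ → ℕ) (n : ℕ) : Prop :=
  ∀ i, 1 ≤ i → i < n → ValidMove i (gameHeap move i) (move i)

lemma ValidUntil.isHeap {move : ℕ → ℕ} {n : ℕ} (h : ValidUntil move n) (hn : 1 ≤ n) :
    IsHeap n (gameHeap move n) :=
  isHeap_gameHeap hn h

lemma ValidUntil.succ {move : ℕ → ℕ} {n : ℕ} (h : ValidUntil move n)
    (hv : ValidMove n (gameHeap move n) (move n)) : ValidUntil move (n + 1) := by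
  intro i h1 h2
  rcases (Nat.lt_succ_iff.1 h2).eq_or_lt with rfl | h2
  · exact hv
  · exact h i h1 h2

/-- The strategy that continues valid moves by moves that are valid for every heap. -/
def ValidUntil.strategy {move : ℕ → ℕ} {n : ℕ} (h : ValidUntil move n)
    (hhalf : ∀ i, n ≤ i → move i = (i + 1) / 2) : Strategy where
  move := move
  valid i hi := by
    by_cases hin : i < n
    · exact h i hi hin
    · rw [hhalf i (not_lt.1 hin)]
      exact validMove_half hi _

section step

variable {move : ℕ → ℕ} {n : ℕ}

lemma gameHeap_succ_last (hn : 1 ≤ n) :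
    gameHeap move (n + 1) (n + 1) = gameHeap move n (move n) := by
  rw [gameHeap_succ _ hn, unRemoveMax_last]

lemma gameHeap_succ_onPath {j : ℕ} (h2 : 2 ≤ j) (hj : j ≤ n) (h : OnPath (move n) j) :
    gameHeap move (n + 1) j = gameHeap move n (j / 2) := by
  rw [gameHeap_succ _ (by omega), unRemoveMax_onPath h2 hj h]

lemma gameHeap_succ_of_ne {j : ℕ} (h2 : 2 ≤ j) (hj : j ≤ n) (h1 : j ≠ move n)
    (h : move n < 2 * j) : gameHeap move (n + 1) j = gameHeap move n j := by
  rw [gameHeap_succ _ (by omega), unRemoveMax_not_onPath h2 hj]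
  intro hp
  rcases hp.eq_or_two_mul_le with h3 | h3 <;> omega

/-- The two last values trade order and advance by one index, so a small pair can be dragged through
a level. -/
lemma gameHeap_pair (hn : 3 ≤ n) (hm : move n = n - 1) :
    gameHeap move (n + 1) (n + 1) = gameHeap move n (n - 1) ∧
      gameHeap move (n + 1) n = gameHeap move n n := by
  rw [gameHeap_succ_last (by omega), hm]
  exact ⟨rfl, gameHeap_succ_of_ne (by omega) le_rfl (by omega) (by omega)⟩

/-- The value `v` follows the indices `c * 2 ^ t` under the moves `n - 1`. -/
lemma gameHeap_follow {c v : ℕ} (hc : 1 ≤ c) (hc3 : c ≤ 3) (hn : 9 ≤ n) (hm : move n = n - 1)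
    (h : ∀ t, c * 2 ^ t + 2 ≤ n → n < c * 2 ^ (t + 1) + 2 → gameHeap move n (c * 2 ^ t) = v) :
    ∀ t, c * 2 ^ t + 2 ≤ n + 1 → n + 1 < c * 2 ^ (t + 1) + 2 →
      gameHeap move (n + 1) (c * 2 ^ t) = v := by
  intro t h1 h2
  have e1 : c * 2 ^ (t + 1) = 2 * (c * 2 ^ t) := by ring
  by_cases h3 : c * 2 ^ t + 2 ≤ n
  · rw [gameHeap_succ_of_ne (by omega) (by omega) (by omega) (by omega)]
    exact h t h3 (by omega)
  -- The move now takes the index `c * 2 ^ t` itself and demotes its parent, which holds `v`, into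
  -- it. Since `c ≤ 3` and `9 ≤ n`, this index is not the starting one.
  · have h4 : c * 2 ^ t = n - 1 := by omega
    obtain ⟨u, rfl⟩ : ∃ u, t = u + 1 := by
      refine ⟨t - 1, ?_⟩
      rcases t with _ | t
      · rw [pow_zero] at h4
        omega
      · rfl
    have e2 : c * 2 ^ (u + 1) = 2 * (c * 2 ^ u) := by ring
    rw [gameHeap_succ_onPath (by omega) (by omega) (by rw [hm, h4]; exact onPath_self _),
      show c * 2 ^ (u + 1) / 2 = c * 2 ^ u by omega]
    exact h u (by omega) (by omega)

end step

/-- Moves that lose a credit at the powers of `2` from `8` to `4 * q` only, until the heap has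
`16 * q - 4` nodes, where `q ≥ 2` is a power of `2`. -/
def pullMove (q i : ℕ) : ℕ :=
  if i ≤ 4 then i
  else if i = 6 * q + 1 then 3 * q
  else if i = 8 * q - 1 then 6 * q
  else if i = 8 * q then 4 * q
  else if i < 16 * q - 4 then i - 1
  else (i + 1) / 2

lemma pullMove_eq_sub_one {q i : ℕ} (h0 : 4 < i) (h1 : i ≠ 6 * q + 1) (h2 : i ≠ 8 * q - 1)
    (h3 : i ≠ 8 * q) (h4 : i < 16 * q - 4) : pullMove q i = i - 1 := by
  rw [pullMove, if_neg (by omega), if_neg h1, if_neg h2, if_neg h3, if_pos h4]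

lemma gameHeap_initialMove :
    (∀ i ∈ Finset.Icc 1 8, ValidMove i (gameHeap (fun i => if i ≤ 4 then i else i - 1) i)
      (if i ≤ 4 then i else i - 1)) ∧
    gameHeap (fun i => if i ≤ 4 then i else i - 1) 9 8 = 2 ∧
    gameHeap (fun i => if i ≤ 4 then i else i - 1) 9 9 = 1 ∧
    gameHeap (fun i => if i ≤ 4 then i else i - 1) 9 6 = 3 ∧
    gameHeap (fun i => if i ≤ 4 then i else i - 1) 9 4 = 4 := by
  refine ⟨?_, ?_, ?_, ?_, ?_⟩
  · simp only [ValidMove]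
    decide
  all_goals decide

/-- The pair 1, 2 travels last; 3 follows the indices `3 * 2 ^ t` and 4 the first nodes of the
levels, to be at hand at the end. -/
lemma pullMove_first_phase {q : ℕ} (hq : 2 ≤ q) {n : ℕ} (h9 : 9 ≤ n) (hn : n ≤ 6 * q + 1) :
    ValidUntil (pullMove q) n ∧
    (n % 2 = 1 → gameHeap (pullMove q) n (n - 1) = 2 ∧ gameHeap (pullMove q) n n = 1) ∧
    (n % 2 = 0 → gameHeap (pullMove q) n (n - 1) = 1 ∧ gameHeap (pullMove q) n n = 2) ∧
    (∀ t, 3 * 2 ^ t + 2 ≤ n → n < 3 * 2 ^ (t + 1) + 2 →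
      gameHeap (pullMove q) n (3 * 2 ^ t) = 3) ∧
    (∀ t, 1 * 2 ^ t + 2 ≤ n → n < 1 * 2 ^ (t + 1) + 2 →
      gameHeap (pullMove q) n (1 * 2 ^ t) = 4) := by
  induction n, h9 using Nat.le_induction with
  | base =>
    have hmove : ∀ i, i < 9 → pullMove q i = if i ≤ 4 then i else i - 1 := by
      intro i hi
      by_cases h4 : i ≤ 4
      · simp [pullMove, h4]
      · rw [if_neg h4, pullMove_eq_sub_one] <;> omega
    have hheap : ∀ n, 1 ≤ n → n ≤ 9 → gameHeap (pullMove q) n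
        = gameHeap (fun i => if i ≤ 4 then i else i - 1) n := fun n h1 h2 =>
      gameHeap_congr h1 fun i _ hi => hmove i (by omega)
    obtain ⟨h0, h1, h2, h3, h4⟩ := gameHeap_initialMove
    rw [hheap 9 (by norm_num) le_rfl]
    refine ⟨?_, fun _ => ⟨h1, h2⟩, fun h => absurd h (by norm_num), ?_, ?_⟩
    · intro i hi hi'
      rw [hheap i hi (by omega), hmove i hi']
      exact h0 i (Finset.mem_Icc.2 ⟨hi, by omega⟩)
    · intro t ht ht'
      match t with
      | 0 => omega
      | 1 => exact h3
      | t + 2 =>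
        have : 1 ≤ 2 ^ t := Nat.one_le_two_pow
        rw [pow_succ, pow_succ] at ht
        omega
    · intro t ht ht'
      match t with
      | 0 => omega
      | 1 => omega
      | 2 => exact h4
      | t + 3 =>
        have : 1 ≤ 2 ^ t := Nat.one_le_two_pow
        rw [pow_succ, pow_succ, pow_succ] at ht
        omega
  | succ n h9 ih =>
    obtain ⟨hv, hodd, heven, h3, h4⟩ := ih (by omega)
    have hm : pullMove q n = n - 1 := by rw [pullMove_eq_sub_one] <;> omega
    have hH := hv.isHeap (by omega)
    have hpair := gameHeap_pair (by omega) hm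
    refine ⟨hv.succ ?_, ?_, ?_, gameHeap_follow (by norm_num) (by norm_num) h9 hm h3,
      gameHeap_follow (by norm_num) (by norm_num) h9 hm h4⟩
    · rw [hm]
      refine ⟨by omega, by omega, ?_⟩
      have h1 := hH.ne (a := (n + 1) / 2) (b := n - 1) (by omega) (by omega) (by omega) (by omega)
        (by omega)
      have h2 := hH.ne (a := (n + 1) / 2) (b := n) (by omega) (by omega) (by omega) (by omega)
        (by omega)
      have h3 := hH.pos (j := (n + 1) / 2) (by omega) (by omega)
      omega
    · intro h
      rw [Nat.add_sub_cancel, hpair.1, hpair.2]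
      exact (heven (by omega)).symm
    · intro h
      rw [Nat.add_sub_cancel, hpair.1, hpair.2]
      exact (hodd (by omega)).symm

/-- The move `3 * q` takes the value 3, which lies above 2 and 1, to the end. This parks 2 at `6 *
q`, and the pair 1, 3 travels on. -/
lemma pullMove_second_phase {d : ℕ} (hd : 1 ≤ d) {n : ℕ} (h6 : 6 * 2 ^ d + 2 ≤ n)
    (hn : n ≤ 8 * 2 ^ d - 1) :
    ValidUntil (pullMove (2 ^ d)) n ∧
    (n % 2 = 0 → gameHeap (pullMove (2 ^ d)) n (n - 1) = 1 ∧
      gameHeap (pullMove (2 ^ d)) n n = 3) ∧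
    (n % 2 = 1 → gameHeap (pullMove (2 ^ d)) n (n - 1) = 3 ∧
      gameHeap (pullMove (2 ^ d)) n n = 1) ∧
    gameHeap (pullMove (2 ^ d)) n (6 * 2 ^ d) = 2 ∧
    gameHeap (pullMove (2 ^ d)) n (4 * 2 ^ d) = 4 := by
  have hq : 2 ≤ 2 ^ d := Nat.pow_le_pow_right (n := 2) (by norm_num) hd
  induction n, h6 using Nat.le_induction with
  | base =>
    obtain ⟨hv, hodd, -, h3, h4⟩ := pullMove_first_phase hq (n := 6 * 2 ^ d + 1) (by omega) le_rfl
    have h3 := h3 d (by omega) (by rw [pow_succ]; omega)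
    have h4 := h4 (d + 2) (by rw [pow_succ, pow_succ]; omega)
      (by rw [pow_succ, pow_succ, pow_succ]; omega)
    rw [show 1 * 2 ^ (d + 2) = 4 * 2 ^ d by ring] at h4
    obtain ⟨h2, h1⟩ := hodd (by omega)
    rw [Nat.add_sub_cancel] at h2
    have hm : pullMove (2 ^ d) (6 * 2 ^ d + 1) = 3 * 2 ^ d := by
      rw [pullMove, if_neg (by omega), if_pos rfl]
    generalize 2 ^ d = q at *
    have hH := hv.isHeap (by omega)
    refine ⟨hv.succ ?_, fun _ => ?_, fun h => by omega, ?_, ?_⟩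
    · rw [hm]
      refine ⟨by omega, by omega, ?_⟩
      have i1 := hH.ne (a := (6 * q + 1 + 1) / 2) (b := 6 * q) (by omega) (by omega) (by omega)
        (by omega) (by omega)
      have i2 := hH.ne (a := (6 * q + 1 + 1) / 2) (b := 6 * q + 1) (by omega) (by omega) (by omega)
        (by omega) (by omega)
      have i3 := hH.pos (j := (6 * q + 1 + 1) / 2) (by omega) (by omega)
      omega
    · constructor
      · rw [show 6 * q + 2 - 1 = 6 * q + 1 by omega,
          gameHeap_succ_of_ne (by omega) le_rfl (by omega) (by omega), h1]
      · rw [gameHeap_succ_last (by omega), hm, h3]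
    · rw [gameHeap_succ_of_ne (by omega) (by omega) (by omega) (by omega), h2]
    · rw [gameHeap_succ_of_ne (by omega) (by omega) (by omega) (by omega), h4]
  | succ n h6 ih =>
    obtain ⟨hv, heven, hodd, h2, h4⟩ := ih (by omega)
    have hm : pullMove (2 ^ d) n = n - 1 := by rw [pullMove_eq_sub_one] <;> omega
    have hpair := gameHeap_pair (by omega) hm
    generalize 2 ^ d = q at *
    have hH := hv.isHeap (by omega)
    refine ⟨hv.succ ?_, ?_, ?_, ?_, ?_⟩
    · rw [hm]
      refine ⟨by omega, by omega, ?_⟩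
      have i1 := hH.ne (a := (n + 1) / 2) (b := n - 1) (by omega) (by omega) (by omega) (by omega)
        (by omega)
      have i2 := hH.ne (a := (n + 1) / 2) (b := n) (by omega) (by omega) (by omega) (by omega)
        (by omega)
      have i3 := hH.ne (a := (n + 1) / 2) (b := 6 * q) (by omega) (by omega) (by omega) (by omega)
        (by omega)
      have i4 := hH.pos (j := (n + 1) / 2) (by omega) (by omega)
      omega
    · intro h
      rw [Nat.add_sub_cancel, hpair.1, hpair.2]
      exact (hodd (by omega)).symm
    · intro h
      rw [Nat.add_sub_cancel, hpair.1, hpair.2]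
      exact (heven (by omega)).symm
    · rw [gameHeap_succ_of_ne (by omega) (by omega) (by omega) (by omega), h2]
    · rw [gameHeap_succ_of_ne (by omega) (by omega) (by omega) (by omega), h4]

/-- The move `6 * q` brings 2 to the index `8 * q`, leaving 3 and 1 at the end of the full level.
Then `4 * q` brings 4 behind it, and 2, 4 travel until 4 would have to be placed below 3. -/
lemma pullMove_third_phase {d : ℕ} (hd : 1 ≤ d) {n : ℕ} (h8 : 8 * 2 ^ d + 1 ≤ n)
    (hn : n ≤ 16 * 2 ^ d - 4) :
    ValidUntil (pullMove (2 ^ d)) n ∧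
    (n % 2 = 1 → gameHeap (pullMove (2 ^ d)) n (n - 1) = 2 ∧
      gameHeap (pullMove (2 ^ d)) n n = 4) ∧
    (n % 2 = 0 → gameHeap (pullMove (2 ^ d)) n (n - 1) = 4 ∧
      gameHeap (pullMove (2 ^ d)) n n = 2) ∧
    gameHeap (pullMove (2 ^ d)) n (8 * 2 ^ d - 2) = 3 ∧
    gameHeap (pullMove (2 ^ d)) n (8 * 2 ^ d - 1) = 1 := by
  have hq : 2 ≤ 2 ^ d := Nat.pow_le_pow_right (n := 2) (by norm_num) hd
  induction n, h8 using Nat.le_induction with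
  | base =>
    obtain ⟨hv, -, hodd, h2, h4⟩ := pullMove_second_phase hd (n := 8 * 2 ^ d - 1) (by omega) le_rfl
    obtain ⟨h3, h1⟩ := hodd (by omega)
    have hm : pullMove (2 ^ d) (8 * 2 ^ d - 1) = 6 * 2 ^ d := by
      rw [pullMove, if_neg (by omega), if_neg (by omega), if_pos rfl]
    have hm' : pullMove (2 ^ d) (8 * 2 ^ d - 1 + 1) = 4 * 2 ^ d := by
      rw [pullMove, if_neg (by omega), if_neg (by omega), if_neg (by omega), if_pos (by omega)]
    generalize 2 ^ d = q at *
    obtain ⟨r, hr⟩ : ∃ r, r = 8 * q - 1 := ⟨_, rfl⟩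
    rw [← hr] at hv h1 h2 h3 h4 hm hm' ⊢
    rw [show 8 * q + 1 = r + 1 + 1 by omega, show 8 * q - 2 = r - 1 by omega]
    have hH := hv.isHeap (by omega)
    have hv1 : ValidUntil (pullMove q) (r + 1) := hv.succ (by
      rw [hm]
      refine ⟨by omega, by omega, ?_⟩
      rw [show (r + 1) / 2 = 4 * q by omega]
      omega)
    have hlast : gameHeap (pullMove q) (r + 1) (r + 1) = 2 := by
      rw [gameHeap_succ_last (by omega), hm, h2]
    have h4' : gameHeap (pullMove q) (r + 1) (4 * q) = 4 := by
      rw [gameHeap_succ_of_ne (by omega) (by omega) (by omega) (by omega), h4]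
    refine ⟨hv1.succ ?_, fun _ => ⟨?_, ?_⟩, fun h => by omega, ?_, ?_⟩
    · rw [hm']
      refine ⟨by omega, by omega, ?_⟩
      rw [show (r + 1 + 1) / 2 = 4 * q by omega]
    · rw [Nat.add_sub_cancel, gameHeap_succ_of_ne (by omega) le_rfl (by omega) (by omega), hlast]
    · rw [gameHeap_succ_last (by omega), hm', h4']
    · rw [gameHeap_succ_of_ne (by omega) (by omega) (by omega) (by omega),
        gameHeap_succ_of_ne (by omega) (by omega) (by omega) (by omega), h3]
    · rw [gameHeap_succ_of_ne (by omega) (by omega) (by omega) (by omega),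
        gameHeap_succ_of_ne (by omega) (by omega) (by omega) (by omega), h1]
  | succ n h8 ih =>
    obtain ⟨hv, hodd, heven, h3, h1⟩ := ih (by omega)
    have hm : pullMove (2 ^ d) n = n - 1 := by rw [pullMove_eq_sub_one] <;> omega
    have hpair := gameHeap_pair (by omega) hm
    generalize 2 ^ d = q at *
    have hH := hv.isHeap (by omega)
    refine ⟨hv.succ ?_, ?_, ?_, ?_, ?_⟩
    · rw [hm]
      refine ⟨by omega, by omega, ?_⟩
      have i1 := hH.ne (a := (n + 1) / 2) (b := n - 1) (by omega) (by omega) (by omega) (by omega)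
        (by omega)
      have i2 := hH.ne (a := (n + 1) / 2) (b := n) (by omega) (by omega) (by omega) (by omega)
        (by omega)
      have i3 := hH.ne (a := (n + 1) / 2) (b := 8 * q - 1) (by omega) (by omega) (by omega)
        (by omega) (by omega)
      have i4 := hH.pos (j := (n + 1) / 2) (by omega) (by omega)
      rcases Nat.mod_two_eq_zero_or_one n with h | h
      · have i5 := hH.ne (a := (n + 1) / 2) (b := 8 * q - 2) (by omega) (by omega) (by omega)
          (by omega) (by omega)
        have := heven h
        omega
      · have := hodd h
        omega
    · intro h
      rw [Nat.add_sub_cancel, hpair.1, hpair.2]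
      exact (heven (by omega)).symm
    · intro h
      rw [Nat.add_sub_cancel, hpair.1, hpair.2]
      exact (hodd (by omega)).symm
    · rw [gameHeap_succ_of_ne (by omega) (by omega) (by omega) (by omega), h3]
    · rw [gameHeap_succ_of_ne (by omega) (by omega) (by omega) (by omega), h1]

lemma Strategy.loss_eq_of_move (s : Strategy) {E i l : ℕ} (hi : 2 ≤ i) (hE : 1 ≤ E)
    (h1 : 2 ^ E ≤ i) (h2 : i < 2 ^ (E + 1)) (hl : 2 ^ l ≤ s.move i)
    (hl' : s.move i < 2 ^ (l + 1)) :
    s.loss i = (maxCredit E i : ℤ) + (if s.move i = i ∧ 2 ∣ i then 1 else 0)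
      - (2 * l + numChildren i (s.move i)) := by
  have key := credit_add (s.isHeap (n := i) (by omega)) (s.one_le_move (by omega))
    (s.move_le (by omega)) hi
  have hlog : Nat.log 2 (s.move i) = l := (Nat.log_eq_iff (by
    have := s.one_le_move (n := i) (by omega)
    omega)).2 ⟨hl, hl'⟩
  rw [hlog] at key
  rw [s.loss_eq hE h1 h2, show s.credit i = PullDowns.credit i (s.heap i) (s.move i) from rfl]
  split_ifs at key ⊢ <;> omega

lemma Strategy.loss_eq_of_move_eq_sub_one (s : Strategy) {E i : ℕ} (hE : 2 ≤ E) (h1 : 2 ^ E ≤ i)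
    (h2 : i < 2 ^ (E + 1)) (hm : s.move i = i - 1) : s.loss i = if i = 2 ^ E then 1 else 0 := by
  obtain ⟨e, rfl⟩ : ∃ e, E = e + 1 := ⟨E - 1, by omega⟩
  have hp : 2 ≤ 2 ^ e := Nat.pow_le_pow_right (n := 2) (by norm_num) (show 1 ≤ e by omega)
  rw [pow_succ 2 (e + 1), pow_succ] at h2
  have hnc : numChildren i (i - 1) = 0 := by
    rw [pow_succ] at h1
    simp only [numChildren]
    split_ifs <;> omega
  by_cases h : i = 2 ^ (e + 1)
  · rw [s.loss_eq_of_move (E := e + 1) (l := e) (by rw [pow_succ] at h1; omega) (by omega) h1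
      (by rw [pow_succ, pow_succ]; omega) (by rw [hm, h, pow_succ]; omega)
      (by rw [hm, h, pow_succ]; omega), hm, hnc, maxCredit, if_pos h, if_pos h,
      if_neg (by rw [h, pow_succ]; omega)]
    push_cast
    omega
  · rw [s.loss_eq_of_move (E := e + 1) (l := e + 1) (by rw [pow_succ] at h1; omega) (by omega) h1
      (by rw [pow_succ, pow_succ]; omega) (by rw [hm]; omega)
      (by rw [hm, pow_succ, pow_succ]; omega), hm, hnc, maxCredit, if_neg h, if_neg h,
      if_neg (by rw [pow_succ] at h1; omega)]
    push_cast
    omega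

/-- The exceptional moves are lossless: `3 * q` has two children, `6 * q` is a leaf of the last
level, and `4 * q` is the parent of an only child at a power of two, where the maximal credit is one
less. The moves `i - 1` lose only at powers of two. -/
lemma Strategy.loss_of_pullMove (s : Strategy) {d : ℕ} (hd : 1 ≤ d)
    (hs : s.move = pullMove (2 ^ d)) {i : ℕ} (hi : 2 ≤ i) (hi' : i < 16 * 2 ^ d - 4) :
    s.loss i ≤ if i ∈ (Finset.Icc 3 (d + 2)).image (2 ^ ·) then 1 else 0 := by
  have hq : 2 ≤ 2 ^ d := Nat.pow_le_pow_right (n := 2) (by norm_num) hd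
  have hnn : (0 : ℤ) ≤ if i ∈ (Finset.Icc 3 (d + 2)).image (2 ^ ·) then 1 else 0 := by
    split_ifs <;> norm_num
  have e1 : 2 ^ (d + 1) = 2 * 2 ^ d := by ring
  have e2 : 2 ^ (d + 2) = 4 * 2 ^ d := by ring
  have e3 : 2 ^ (d + 3) = 8 * 2 ^ d := by ring
  have e4 : 2 ^ (d + 4) = 16 * 2 ^ d := by ring
  by_cases h4 : i ≤ 4
  · have hm : s.move i = i := by rw [hs, pullMove, if_pos h4]
    refine le_trans (le_of_eq ?_) hnn
    obtain rfl | rfl | rfl : i = 2 ∨ i = 3 ∨ i = 4 := by omega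
    · rw [s.loss_eq_of_move (E := 1) (l := 1) (by norm_num) (by norm_num) (by norm_num)
        (by norm_num) (by rw [hm]; norm_num) (by rw [hm]; norm_num), hm]
      decide
    · rw [s.loss_eq_of_move (E := 1) (l := 1) (by norm_num) (by norm_num) (by norm_num)
        (by norm_num) (by rw [hm]; norm_num) (by rw [hm]; norm_num), hm]
      decide
    · rw [s.loss_eq_of_move (E := 2) (l := 2) (by norm_num) (by norm_num) (by norm_num)
        (by norm_num) (by rw [hm]; norm_num) (by rw [hm]; norm_num), hm]
      decide
  by_cases h6 : i = 6 * 2 ^ d + 1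
  · have hm : s.move i = 3 * 2 ^ d := by rw [hs, pullMove, if_neg h4, if_pos h6]
    refine le_trans (le_of_eq ?_) hnn
    rw [s.loss_eq_of_move (E := d + 2) (l := d + 1) (by omega) (by omega) (by omega)
      (by rw [e3]; omega) (by omega) (by rw [hm, e2]; omega), hm, maxCredit, if_neg (by omega),
      if_neg (by omega), numChildren, if_pos (by omega)]
    push_cast
    ring
  by_cases h7 : i = 8 * 2 ^ d - 1
  · have hm : s.move i = 6 * 2 ^ d := by rw [hs, pullMove, if_neg h4, if_neg h6, if_pos h7]
    refine le_trans (le_of_eq ?_) hnn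
    rw [s.loss_eq_of_move (E := d + 2) (l := d + 2) (by omega) (by omega) (by omega)
      (by rw [e3]; omega) (by omega) (by rw [hm, e3]; omega), hm, maxCredit, if_neg (by omega),
      if_neg (by omega), numChildren, if_neg (by omega), if_neg (by omega)]
    push_cast
    ring
  by_cases h8 : i = 8 * 2 ^ d
  · have hm : s.move i = 4 * 2 ^ d := by
      rw [hs, pullMove, if_neg h4, if_neg h6, if_neg h7, if_pos h8]
    refine le_trans (le_of_eq ?_) hnn
    rw [s.loss_eq_of_move (E := d + 3) (l := d + 2) (by omega) (by omega) (by omega)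
      (by rw [e4]; omega) (by omega) (by rw [hm, e3]; omega), hm, maxCredit, if_pos (by omega),
      if_neg (by omega), numChildren, if_neg (by omega), if_pos (by omega)]
    push_cast
    omega
  have hm : s.move i = i - 1 := by
    rw [hs, pullMove_eq_sub_one (by omega) h6 h7 h8 hi']
  have hl1 := Nat.pow_log_le_self 2 (x := i) (by omega)
  have hl2 := Nat.lt_pow_succ_log_self (b := 2) (by norm_num) i
  have hl : 2 ≤ Nat.log 2 i := (Nat.le_log_iff_pow_le (by norm_num) (by omega)).2 (by omega)
  rw [s.loss_eq_of_move_eq_sub_one hl hl1 hl2 hm]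
  by_cases hp : i = 2 ^ Nat.log 2 i
  · rw [if_pos hp, if_pos]
    refine Finset.mem_image.2 ⟨Nat.log 2 i, Finset.mem_Icc.2 ⟨?_, ?_⟩, hp.symm⟩
    · by_contra h
      rw [show Nat.log 2 i = 2 by omega] at hp
      omega
    · by_contra h
      have h9 : Nat.log 2 i < d + 4 := Nat.log_lt_of_lt_pow (by omega) (by omega)
      rw [show Nat.log 2 i = d + 3 by omega] at hp
      omega
  · rw [if_neg hp]
    exact hnn

lemma exists_strategy_sum_loss_le {d : ℕ} (hd : 1 ≤ d) : ∃ s : Strategy, ∀ M,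
    M ≤ 16 * 2 ^ d - 5 → ∑ i ∈ Finset.Icc 2 M, s.loss i ≤ d := by
  have hq : 2 ≤ 2 ^ d := Nat.pow_le_pow_right (n := 2) (by norm_num) hd
  have hv := (pullMove_third_phase hd (n := 16 * 2 ^ d - 4) (by omega) le_rfl).1
  refine ⟨hv.strategy fun i hi => ?_, fun M hM => ?_⟩
  · rw [pullMove, if_neg (by omega), if_neg (by omega), if_neg (by omega), if_neg (by omega),
      if_neg (by omega)]
  · calc _ ≤ ∑ i ∈ Finset.Icc 2 M,
          (if i ∈ (Finset.Icc 3 (d + 2)).image (2 ^ ·) then (1 : ℤ) else 0) :=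
        Finset.sum_le_sum fun i hi => Strategy.loss_of_pullMove _ hd rfl (Finset.mem_Icc.1 hi).1
          (by have := (Finset.mem_Icc.1 hi).2; omega)
      _ ≤ ((Finset.Icc 3 (d + 2)).image (2 ^ ·)).card := by
        rw [Finset.sum_ite_mem, Finset.sum_const, nsmul_eq_mul, mul_one]
        exact_mod_cast Finset.card_le_card Finset.inter_subset_right
      _ ≤ (Finset.Icc 3 (d + 2)).card := by exact_mod_cast Finset.card_image_le
      _ = d := by simp

/-- Moves without loss of credit on the heaps on at most `11` nodes. -/
def losslessMove (i : ℕ) : ℕ :=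
  if i ≤ 3 then i else if i = 4 then 2 else if i = 8 then 4 else if i ≤ 11 then i - 1
  else (i + 1) / 2

lemma exists_strategy_loss_eq_zero : ∃ s : Strategy, ∀ M, M ≤ 11 →
    ∑ i ∈ Finset.Icc 2 M, s.loss i = 0 := by
  have hv : ValidUntil losslessMove 12 := by
    have : ∀ i ∈ Finset.Icc 1 11, ValidMove i (gameHeap losslessMove i) (losslessMove i) := by
      simp only [ValidMove]
      decide
    intro i hi hi'
    exact this i (Finset.mem_Icc.2 ⟨hi, by omega⟩)
  refine ⟨hv.strategy fun i hi => ?_, fun M hM => Finset.sum_eq_zero fun i hi => ?_⟩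
  · rw [losslessMove, if_neg (by omega), if_neg (by omega), if_neg (by omega), if_neg (by omega)]
  · rw [Finset.mem_Icc] at hi
    generalize hs : hv.strategy _ = s
    have hm : s.move = losslessMove := by rw [← hs]; rfl
    have key : ∀ E l : ℕ, 1 ≤ E → 2 ^ E ≤ i → i < 2 ^ (E + 1) → 2 ^ l ≤ losslessMove i →
        losslessMove i < 2 ^ (l + 1) → (maxCredit E i : ℤ) +
          (if losslessMove i = i ∧ 2 ∣ i then 1 else 0)
          - (2 * l + numChildren i (losslessMove i)) = 0 → s.loss i = 0 := by
      intro E l hE h1 h2 h3 h4 h5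
      rw [← hm] at h3 h4 h5
      rw [s.loss_eq_of_move hi.1 hE h1 h2 h3 h4, h5]
    obtain ⟨h1, h2⟩ : 2 ≤ i ∧ i ≤ 11 := ⟨hi.1, by omega⟩
    clear hi
    interval_cases i
    · exact key 1 1 (by decide) (by decide) (by decide) (by decide) (by decide) (by decide)
    · exact key 1 1 (by decide) (by decide) (by decide) (by decide) (by decide) (by decide)
    · exact key 2 1 (by decide) (by decide) (by decide) (by decide) (by decide) (by decide)
    · exact key 2 2 (by decide) (by decide) (by decide) (by decide) (by decide) (by decide)
    · exact key 2 2 (by decide) (by decide) (by decide) (by decide) (by decide) (by decide)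
    · exact key 2 2 (by decide) (by decide) (by decide) (by decide) (by decide) (by decide)
    · exact key 3 2 (by decide) (by decide) (by decide) (by decide) (by decide) (by decide)
    · exact key 3 3 (by decide) (by decide) (by decide) (by decide) (by decide) (by decide)
    · exact key 3 3 (by decide) (by decide) (by decide) (by decide) (by decide) (by decide)
    · exact key 3 3 (by decide) (by decide) (by decide) (by decide) (by decide) (by decide)

lemma exists_strategy_sum_loss_eq {M : ℕ} (hM : 1 ≤ M) : ∃ s : Strategy,
    ∑ i ∈ Finset.Icc 2 M, s.loss i = ∑ i ∈ Finset.Icc 2 M, delayedLoss i := by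
  have key : ∃ s : Strategy,
      ∑ i ∈ Finset.Icc 2 M, s.loss i ≤ ∑ i ∈ Finset.Icc 2 M, delayedLoss i := by
    rw [sum_delayedLoss hM]
    have hl2 := Nat.lt_pow_succ_log_self (b := 2) (by norm_num) (M + 4)
    by_cases hl : Nat.log 2 (M + 4) ≤ 3
    · obtain ⟨s, hs⟩ := exists_strategy_loss_eq_zero
      have : M + 4 < 2 ^ 4 := hl2.trans_le (Nat.pow_le_pow_right (by norm_num) (by omega))
      refine ⟨s, ?_⟩
      rw [hs M (by omega), max_eq_right hl]
      norm_num
    · obtain ⟨d, hd⟩ : ∃ d, Nat.log 2 (M + 4) = d + 3 := ⟨Nat.log 2 (M + 4) - 3, by omega⟩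
      obtain ⟨s, hs⟩ := exists_strategy_sum_loss_le (d := d) (by omega)
      rw [hd, Nat.succ_eq_add_one, show 2 ^ (d + 3 + 1) = 16 * 2 ^ d by ring] at hl2
      refine ⟨s, (hs M (by omega)).trans ?_⟩
      rw [hd]
      omega
  obtain ⟨s, hs⟩ := key
  exact ⟨s, le_antisymm hs (s.sum_delayedLoss_le hM)⟩

/-! ### Optimality in terms of losses. -/

lemma Strategy.sum_loss_add_payoff (s : Strategy) (M : ℕ) :
    ∑ i ∈ Finset.Icc 2 M, s.loss i + s.payoff 2 M = ∑ i ∈ Finset.Icc 2 M, (creditMax i : ℤ) := by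
  simp only [Strategy.loss, Finset.sum_sub_distrib, Strategy.payoff]
  push_cast
  ring

/-- Maximal payoff is minimal total loss, and the delayed loss is a lower bound attained by some
strategy for each horizon. -/
lemma Strategy.isOptimal_iff (s : Strategy) {N : ℕ} (hN : 2 ≤ N) : s.IsOptimal N ↔
    ∑ i ∈ Finset.Icc 2 (N - 1), s.loss i = ∑ i ∈ Finset.Icc 2 (N - 1), delayedLoss i := by
  have hs := s.sum_loss_add_payoff (N - 1)
  constructor
  · intro h
    obtain ⟨u, hu⟩ := exists_strategy_sum_loss_eq (M := N - 1) (by omega)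
    have h1 := u.sum_loss_add_payoff (N - 1)
    have h2 := s.sum_delayedLoss_le (M := N - 1) (by omega)
    have h3 := h u
    omega
  · intro h u
    have h1 := u.sum_loss_add_payoff (N - 1)
    have h2 := u.sum_delayedLoss_le (M := N - 1) (by omega)
    omega

end PullDowns

theorem mainTheorem9 :
    (∀ (s : PullDowns.Strategy) (N : ℕ), 2 ≤ N →
      ∑ i ∈ Finset.Icc 2 N, PullDowns.delayedLoss i ≤ ∑ i ∈ Finset.Icc 2 N, s.loss i) ∧
    (∀ (s : PullDowns.Strategy) (N : ℕ), 2 ≤ N →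
      (s.IsOptimal N ↔
        ∑ i ∈ Finset.Icc 2 (N - 1), s.loss i
          = ∑ i ∈ Finset.Icc 2 (N - 1), PullDowns.delayedLoss i)) ∧
    (∀ N : ℕ, 2 ≤ N →
      ∑ i ∈ Finset.Icc 2 (N - 1), PullDowns.delayedLoss i
        = max (⌊Real.logb 2 ((N : ℝ) + 3)⌋) 3 - 3) := by
  refine ⟨fun s N hN => s.sum_delayedLoss_le (by omega), fun s N hN => s.isOptimal_iff hN,
    fun N hN => ?_⟩
  rw [PullDowns.sum_delayedLoss (by omega), show N - 1 + 4 = N + 3 by omega]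
  have h := Real.floor_logb_natCast (b := 2) (r := (N : ℝ) + 3) (by positivity)
  rw [Nat.cast_ofNat] at h
  rw [h, show ((N : ℝ) + 3) = ((N + 3 : ℕ) : ℝ) by push_cast; ring, Int.log_natCast]
  push_cast
  rfl
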